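/- **Conventions.** A *scwol* (small category without loops) $X$ consists of a set $VX$ of vertices, a set $EX$ of edges, maps $i,t:EX\to VX$ and a product $(a,b)\mapsto ab\in EX$ defined for $a,b\in EX$ with $i(a)=t(b)$, such that $i(ab)=i(b)$, $t(ab)=t(a)$, $(ab)c=a(bc)$ whenever defined, and $i(a)\ne t(a)$. A *morphism* $f:X\to Y$ of scwols maps vertices to vertices and edges to edges, commutes with $i$, $t$ and products, and restricts for every $\sigma\in VX$ to a bijection from $\{a: i(a)=\sigma\}$ to $\{a': i(a')=f(\sigma)\}$; it is an *isomorphism* if it is bijective on vertices and on edges. To every $a\in EX$ belongs a formal inverse edge $a^{-1}$ with $i(a^{-1})=t(a)$, $t(a^{-1})=i(a)$; $X$ is connected if any two vertices are joined by a finite path of edges and inverse edges. An *action* of a group $\Gamma$ on a scwol is an action by automorphisms with $g\cdot i(a)\neq t(a)$ for all $g,a$, and $g\cdot a=a$ whenever $g\cdot i(a)=i(a)$. A *complex of groups* $\mathbb X$ over $X$ consists of groups $G_\sigma$ ($\sigma\in VX$), injective homomorphisms $\psi_a:G_{i(a)}\to G_{t(a)}$ ($a\in EX$) and elements $g_{a,b}\in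 G_{t(a)}$ (for $i(a)=t(b)$) with $g_{a,b}\,\psi_{ab}(g)\,g_{a,b}^{-1}=\psi_a(\psi_b(g))$ and $\psi_a(g_{b,c})g_{a,bc}=g_{a,b}g_{ab,c}$. A *morphism* $\phi:\mathbb X\to\mathbb Y$ over a morphism $f:X\to Y$ consists of homomorphisms $\phi_\sigma:G_\sigma\to G_{f(\sigma)}$ and elements $\phi(a)\in G_{f(t(a))}$ with $\phi(a)\psi_{f(a)}(\phi_{i(a)}(g))\phi(a)^{-1}=\phi_{t(a)}(\psi_a(g))$ and $\phi_{t(a)}(g_{a,b})\phi(ab)=\phi(a)\psi_{f(a)}(\phi(b))g_{f(a),f(b)}$; it is an isomorphism if $f$ and all $\phi_\sigma$ are isomorphisms. It is a *covering* if $f$ is surjective (on vertices and edges), every $\phi_\sigma$ is injective, and for all $\sigma\in VX$ and $a'\in EY$ with $t(a')=f(\sigma)$ the map $$\coprod_{a\in f^{-1}(a'),\,t(a)=\sigma}G_\sigma/\psi_a(G_{i(a)})\to G_{f(\sigma)}/\psi_{a'}(G_{i(a')}),\qquad g\,\psi_a(G_{i(a)})\mapsto\phi_\sigma(g)\phi(a)\,\psi_{a'}(G_{i(a')})$$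 is a bijection. Given an action of $\Gamma$ on a scwol $Z$ with quotient scwol $X=Z/\Gamma$, choose for every $\sigma\in VX$ a vertex $\tilde\sigma$ above $\sigma$, for every $a\in EX$ the edge $\tilde a$ above $a$ with $i(\tilde a)=\widetilde{i(a)}$, and $h_a\in\Gamma$ with $h_a\cdot t(\tilde a)=\widetilde{t(a)}$. The associated complex of groups over $X$ has $G_\sigma=\mathrm{Stab}_\Gamma(\tilde\sigma)$, $\psi_a(g)=h_agh_a^{-1}$, $g_{a,b}=h_ah_bh_{ab}^{-1}$. A complex of groups is *developable* if it is isomorphic to one associated with an action. An *$\mathbb X$-path* is a tuple $p=(g_0,e_1,g_1,\dots,e_k,g_k)$, $k\ge0$, where $(e_1,\dots,e_k)$ is a path of edges and inverse edges and the $g_j$ lie in the local groups at the successive vertices; if $q=(g_0',e_1',\dots)$ starts where $p$ ends, then $p\star q:=(g_0,e_1,\dots,e_k,g_kg_0',e_1',\dots)$. *Homotopy* of $\mathbb X$-paths is the equivalence relation generated by the following replacements of subpaths: $(kg,a,h)\to(k,a,\psi_a(g)h)$; $(g,a^{-1},hk)\to(g\psi_a(h),a^{-1},k)$; $(g,a,\psi_a(h),a^{-1},k)\to(ghk)$;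 $(g,b^{-1},h,b,k)\to(g\psi_b(h)k)$; $(g,b,1,a,k)\to(g,ab,g_{a,b}^{-1}k)$; $(g,a^{-1},1,b^{-1},k)\to(gg_{a,b},(ab)^{-1},k)$. Homotopy classes $[p]$ of loops at $\sigma_0$ form the group $\pi_1(\mathbb X,\sigma_0)$ under $[p][q]=[p\star q]$. For paths $p,q$ issuing from $\sigma_0$ and ending at the same vertex $\tau$ let $p\equiv q$ if $[q]=[p\star(g)]$ for some $g\in G_\tau$, and let $[p\rangle$ be the class of $p$. The *universal complex* $\tilde X_{\sigma_0}$ is the scwol with vertices $[p\rangle$, for $\mathbb X$-paths $p$ issuing from $\sigma_0$, and edges $([p\rangle,a,[p\star(1,a,1)\rangle)$ with $a\in EX$, $i(a)=t(p)$, directed from the first to the third entry, where the product of $([p\star(1,b,1)\rangle,a,[p\star(1,b,1,a,1)\rangle)$ and $([p\rangle,b,[p\star(1,b,1)\rangle)$ is $([p\rangle,ab,[p\star(1,ab,1)\rangle)$. The group $\pi_1(\mathbb X,\sigma_0)$ acts on it by $[q]\cdot[p\rangle=[q\star p\rangle$ and $[q]\cdot([p\rangle,a,[p\star(1,a,1)\rangle)=([q\star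 p\rangle,a,[q\star p\star(1,a,1)\rangle)$. For a morphism $\phi$ over $f$, let $\mathfrak p_\phi$ be the map on paths that is multiplicative for $\star$ with $(g)\mapsto(\phi_\sigma(g))$, $(1,a,1)\mapsto(1,f(a),\phi(a)^{-1})$, $(1,a^{-1},1)\mapsto(\phi(a),f(a)^{-1},1)$. It induces a homomorphism $\phi_*:\pi_1(\mathbb X,\sigma_0)\to\pi_1(\mathbb Y,f(\sigma_0))$, $[p]\mapsto[\mathfrak p_\phi(p)]$, and a morphism of scwols $\tilde\phi:\tilde X_{\sigma_0}\to\tilde Y_{f(\sigma_0)}$ with $[p\rangle\mapsto[\mathfrak p_\phi(p)\rangle$ which maps the edge over $a$ issuing from $[p\rangle$ to the edge over $f(a)$ issuing from $[\mathfrak p_\phi(p)\rangle$. **Statement.** Let $\mathbb X$ and $\mathbb Y$ be developable complexes of groups over connected scwols $X$ and $Y$, let $\phi:\mathbb X\to\mathbb Y$ be a covering over a morphism $f:X\to Y$, let $\sigma_0\in VX$ and $\tau_0=f(\sigma_0)$. Then the morphism $\tilde\phi:\tilde X_{\sigma_0}\to\tilde Y_{\tau_0}$ is $\phi_*$-equivariant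 and is an isomorphism of scwols. -/

import Mathlib

universe u v w u' v' w'

/-- A small category without loops: a set `V` of vertices and, for all vertices `σ`, `τ`, the set
`Edge σ τ` of edges `a` with initial vertex `i(a) = σ` and terminal vertex `t(a) = τ`.
The product `comp a b = ab` is defined exactly when `i(a) = t(b)`. -/
structure Scwol : Type (max (u + 1) (v + 1)) where
  V : Type u
  Edge : V → V → Type v
  comp : ∀ {ρ σ τ : V}, Edge σ τ → Edge ρ σ → Edge ρ τ
  comp_assoc : ∀ {π ρ σ τ : V} (a : Edge σ τ) (b : Edge ρ σ) (c : Edge π ρ),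
    comp (comp a b) c = comp a (comp b c)
  no_loops : ∀ {σ : V}, Edge σ σ → False

namespace Scwol

/-- The set of all edges. -/
def AllEdges (X : Scwol.{u, v}) : Type (max u v) := Σ σ τ : X.V, X.Edge σ τ

/-- An edge, as an element of the set of all edges. -/
def tot (X : Scwol.{u, v}) {σ τ : X.V} (a : X.Edge σ τ) : X.AllEdges := ⟨σ, τ, a⟩

/-- The set of edges with initial vertex `σ`. -/
def OutEdges (X : Scwol.{u, v}) (σ : X.V) : Type (max u v) := Σ τ : X.V, X.Edge σ τ

/-- The set of edges with terminal vertex `τ`. -/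
def InEdges (X : Scwol.{u, v}) (τ : X.V) : Type (max u v) := Σ σ : X.V, X.Edge σ τ

/-- Oriented edges from `σ` to `τ`: either `Sum.inl a`, an edge `a` from `σ` to `τ`, or
`Sum.inr a`, the formal inverse of an edge `a` from `τ` to `σ`. -/
abbrev OEdge (X : Scwol.{u, v}) (σ τ : X.V) : Type v := X.Edge σ τ ⊕ X.Edge τ σ

/-- Any two vertices are joined by a finite path of oriented edges. -/
def Connected (X : Scwol.{u, v}) : Prop :=
  ∀ σ τ : X.V, Relation.ReflTransGen (fun α β => Nonempty (X.OEdge α β)) σ τ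

/-- A (nondegenerate) morphism of scwols. -/
structure Hom (X : Scwol.{u, v}) (Y : Scwol.{u', v'}) where
  onV : X.V → Y.V
  onE : ∀ {σ τ : X.V}, X.Edge σ τ → Y.Edge (onV σ) (onV τ)
  map_comp : ∀ {ρ σ τ : X.V} (a : X.Edge σ τ) (b : X.Edge ρ σ),
    onE (X.comp a b) = Y.comp (onE a) (onE b)
  star_bijective : ∀ σ : X.V, Function.Bijective
    (fun x : X.OutEdges σ => (⟨onV x.1, onE x.2⟩ : Y.OutEdges (onV σ)))

namespace Hom

variable {X : Scwol.{u, v}} {Y : Scwol.{u', v'}}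

/-- The map induced on the sets of all edges. -/
def onAll (f : Hom X Y) (e : X.AllEdges) : Y.AllEdges := Y.tot (f.onE e.2.2)

/-- The map induced on the sets of edges terminating at a given vertex. -/
def onIn (f : Hom X Y) {τ : X.V} (x : X.InEdges τ) : Y.InEdges (f.onV τ) :=
  ⟨f.onV x.1, f.onE x.2⟩

def IsSurjective (f : Hom X Y) : Prop :=
  Function.Surjective f.onV ∧ Function.Surjective f.onAll

/-- A morphism of scwols is an isomorphism if it is bijective on vertices and on edges. -/
def IsIso (f : Hom X Y) : Prop :=
  Function.Bijective f.onV ∧ Function.Bijective f.onAll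

end Hom

/-- An action of a group on a scwol by automorphisms, with the two conditions
`g • i(a) ≠ t(a)`, and `g • a = a` whenever `g • i(a) = i(a)`. -/
structure Action (Γ : Type w) [Group Γ] (Z : Scwol.{u, v}) where
  onV : MulAction Γ Z.V
  onE : ∀ (g : Γ) {x y : Z.V}, Z.Edge x y → Z.Edge (g • x) (g • y)
  one_onE : ∀ {x y : Z.V} (a : Z.Edge x y), Z.tot (onE 1 a) = Z.tot a
  mul_onE : ∀ (g h : Γ) {x y : Z.V} (a : Z.Edge x y),
    Z.tot (onE (g * h) a) = Z.tot (onE g (onE h a))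
  onE_comp : ∀ (g : Γ) {x y z : Z.V} (a : Z.Edge y z) (b : Z.Edge x y),
    onE g (Z.comp a b) = Z.comp (onE g a) (onE g b)
  smul_initial_ne_terminal : ∀ (g : Γ) {x y : Z.V}, Z.Edge x y → g • x ≠ y
  onE_eq_of_fix : ∀ (g : Γ) {x y : Z.V} (a : Z.Edge x y), g • x = x → Z.tot (onE g a) = Z.tot a

/-- A model of the quotient of a scwol `Z` by an action: a surjective morphism `proj` onto a scwol
`X`, on vertices and on edges, whose fibres are exactly the orbits. -/
structure Action.Quot {Γ : Type w} [Group Γ] {Z : Scwol.{u, v}} (A : Action Γ Z)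
    (X : Scwol.{u', v'}) where
  proj : Hom Z X
  surjective : proj.IsSurjective
  onV_eq_iff : ∀ x y : Z.V, proj.onV x = proj.onV y ↔ ∃ g : Γ, A.onV.smul g x = y
  onE_eq_iff : ∀ {x y x' y' : Z.V} (a : Z.Edge x y) (b : Z.Edge x' y'),
    X.tot (proj.onE a) = X.tot (proj.onE b) ↔ ∃ g : Γ, Z.tot (A.onE g a) = Z.tot b

/-- The choices that determine the complex of groups associated with an action: for every vertex
`σ` of the quotient a vertex `lift σ` above it, for every edge `a` of the quotient the edge
`liftE a` above it that starts at the lift of `i(a)`, and an element `h a` of the group that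
carries the terminal vertex of `liftE a` to the lift of `t(a)`. -/
structure Action.Quot.Choice {Γ : Type w} [Group Γ] {Z : Scwol.{u, v}} {A : Action Γ Z}
    {X : Scwol.{u', v'}} (q : A.Quot X) where
  lift : X.V → Z.V
  proj_lift : ∀ σ : X.V, q.proj.onV (lift σ) = σ
  endpt : ∀ {σ τ : X.V}, X.Edge σ τ → Z.V
  liftE : ∀ {σ τ : X.V} (a : X.Edge σ τ), Z.Edge (lift σ) (endpt a)
  proj_liftE : ∀ {σ τ : X.V} (a : X.Edge σ τ), X.tot (q.proj.onE (liftE a)) = X.tot a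
  h : ∀ {σ τ : X.V}, X.Edge σ τ → Γ
  h_smul : ∀ {σ τ : X.V} (a : X.Edge σ τ), A.onV.smul (h a) (endpt a) = lift τ

end Scwol

/-- A complex of groups over a scwol `X`: local groups `G σ`, boundary monomorphisms `ψ a`, and
twisting elements `tw a b`. -/
structure ComplexOfGroups (X : Scwol.{u, v}) where
  G : X.V → Type w
  [group : ∀ σ : X.V, Group (G σ)]
  ψ : ∀ {σ τ : X.V}, X.Edge σ τ → (G σ →* G τ)
  ψ_injective : ∀ {σ τ : X.V} (a : X.Edge σ τ), Function.Injective (ψ a)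
  tw : ∀ {ρ σ τ : X.V}, X.Edge σ τ → X.Edge ρ σ → G τ
  tw_conj : ∀ {ρ σ τ : X.V} (a : X.Edge σ τ) (b : X.Edge ρ σ) (g : G ρ),
    tw a b * ψ (X.comp a b) g * (tw a b)⁻¹ = ψ a (ψ b g)
  cocycle : ∀ {π ρ σ τ : X.V} (a : X.Edge σ τ) (b : X.Edge ρ σ) (c : X.Edge π ρ),
    ψ a (tw b c) * tw a (X.comp b c) = tw a b * tw (X.comp a b) c

attribute [instance] ComplexOfGroups.group

namespace Scwol

/-- Elimination of an equality of edges of the form `tot a = tot b` with the same initial vertex. -/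
theorem tot_out {X : Scwol.{u, v}} {σ τ τ' : X.V} {a : X.Edge σ τ} {b : X.Edge σ τ'}
    (h : X.tot a = X.tot b) : (⟨τ, a⟩ : X.OutEdges σ) = ⟨τ', b⟩ := by
  unfold tot at h
  exact eq_of_heq (Sigma.mk.inj h).2

theorem tot_initial {X : Scwol.{u, v}} {σ τ σ' τ' : X.V} {a : X.Edge σ τ} {b : X.Edge σ' τ'}
    (h : X.tot a = X.tot b) : σ = σ' := congrArg (fun e : X.AllEdges => e.1) h

theorem tot_terminal {X : Scwol.{u, v}} {σ τ σ' τ' : X.V} {a : X.Edge σ τ} {b : X.Edge σ' τ'}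
    (h : X.tot a = X.tot b) : τ = τ' := congrArg (fun e : X.AllEdges => e.2.1) h

theorem tot_comp {X : Scwol.{u, v}} {ρ σ τ ρ' σ' τ' : X.V} {a : X.Edge σ τ} {b : X.Edge ρ σ}
    {a' : X.Edge σ' τ'} {b' : X.Edge ρ' σ'} (ha : X.tot a = X.tot a') (hb : X.tot b = X.tot b') :
    X.tot (X.comp a b) = X.tot (X.comp a' b') := by
  cases ha; cases hb; rfl

theorem Hom.tot_onE {X : Scwol.{u, v}} {Y : Scwol.{u', v'}} (f : Hom X Y) {σ τ σ' τ' : X.V}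
    {a : X.Edge σ τ} {b : X.Edge σ' τ'} (h : X.tot a = X.tot b) :
    Y.tot (f.onE a) = Y.tot (f.onE b) := by
  cases h; rfl

/-- Edges issuing from one vertex and with the same image are equal. -/
theorem Hom.eq_of_tot {X : Scwol.{u, v}} {Y : Scwol.{u', v'}} (f : Hom X Y) {σ τ τ' : X.V}
    {a : X.Edge σ τ} {b : X.Edge σ τ'} (h : Y.tot (f.onE a) = Y.tot (f.onE b)) :
    X.tot a = X.tot b := by
  have := (f.star_bijective σ).1 (a₁ := ⟨τ, a⟩) (a₂ := ⟨τ', b⟩) (tot_out h)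
  cases this; rfl

namespace Action.Quot.Choice

variable {Γ : Type w} [Group Γ] {Z : Scwol.{u, v}} {A : Action Γ Z}
  {X : Scwol.{u', v'}} {q : A.Quot X} (c : q.Choice)

/-- The isotropy group of the chosen vertex above `σ`. -/
def stab (σ : X.V) : Subgroup Γ := @MulAction.stabilizer Γ Z.V _ A.onV (c.lift σ)

theorem mem_stab {σ : X.V} {g : Γ} : g ∈ c.stab σ ↔ A.onV.smul g (c.lift σ) = c.lift σ := Iff.rfl

theorem conj_mem {σ τ : X.V} (a : X.Edge σ τ) {g : Γ} (hg : g ∈ c.stab σ) :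
    c.h a * g * (c.h a)⁻¹ ∈ c.stab τ := by
  let _ := A.onV
  have h1 : g • c.endpt a = c.endpt a := tot_terminal (A.onE_eq_of_fix g (c.liftE a) hg)
  have h2 : c.h a • c.endpt a = c.lift τ := c.h_smul a
  change (c.h a * g * (c.h a)⁻¹) • c.lift τ = c.lift τ
  rw [← h2, mul_smul, mul_smul, inv_smul_smul, h1]

theorem h_smul_endpt {ρ σ τ : X.V} (a : X.Edge σ τ) (b : X.Edge ρ σ) :
    A.onV.smul (c.h b) (c.endpt (X.comp a b)) = c.endpt a := by
  let _ := A.onV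
  have hb : c.h b • c.endpt b = c.lift σ := c.h_smul b
  have hb' : (c.h b)⁻¹ • c.lift σ = c.endpt b := by rw [← hb, inv_smul_smul]
  -- the translate of the lift of `a` starting at the end of the lift of `b`
  obtain ⟨y, e, hy, he⟩ : ∃ (y : Z.V) (e : Z.Edge (c.endpt b) y),
      y = (c.h b)⁻¹ • c.endpt a ∧ Z.tot e = Z.tot (A.onE (c.h b)⁻¹ (c.liftE a)) := by
    refine hb' ▸ ⟨_, A.onE (c.h b)⁻¹ (c.liftE a), rfl, rfl⟩
  have h1 : X.tot (q.proj.onE e) = X.tot a := by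
    rw [q.proj.tot_onE he, ← c.proj_liftE a]
    refine (q.onE_eq_iff _ _).2 ⟨c.h b, ?_⟩
    rw [← A.mul_onE, mul_inv_cancel, A.one_onE]
  have h2 : X.tot (q.proj.onE (Z.comp e (c.liftE b))) =
      X.tot (q.proj.onE (c.liftE (X.comp a b))) := by
    rw [q.proj.map_comp, c.proj_liftE]
    exact tot_comp h1 (c.proj_liftE b)
  have h3 := tot_terminal (q.proj.eq_of_tot h2)
  change c.h b • c.endpt (X.comp a b) = c.endpt a
  rw [← h3, hy, smul_inv_smul]

theorem tw_mem {ρ σ τ : X.V} (a : X.Edge σ τ) (b : X.Edge ρ σ) :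
    c.h a * c.h b * (c.h (X.comp a b))⁻¹ ∈ c.stab τ := by
  let _ := A.onV
  have h1 : c.h (X.comp a b) • c.endpt (X.comp a b) = c.lift τ := c.h_smul _
  have h2 : c.h b • c.endpt (X.comp a b) = c.endpt a := c.h_smul_endpt a b
  have h3 : c.h a • c.endpt a = c.lift τ := c.h_smul a
  change (c.h a * c.h b * (c.h (X.comp a b))⁻¹) • c.lift τ = c.lift τ
  conv_lhs => rw [← h1]
  rw [mul_smul, mul_smul, inv_smul_smul, h2, h3]

/-- The complex of groups associated with an action: the local groups are the isotropy groups of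
the chosen vertices, `ψ_a` is the conjugation by `h_a`, and `g_{a,b} = h_a h_b h_{ab}⁻¹`. -/
def complex : ComplexOfGroups.{u', v', w} X where
  G σ := c.stab σ
  ψ {σ τ} a :=
    { toFun := fun g => ⟨c.h a * g * (c.h a)⁻¹, c.conj_mem a g.2⟩
      map_one' := by ext; simp
      map_mul' := fun x y => by ext; simp }
  ψ_injective {σ τ} a := fun x y hxy => by
    have := congrArg Subtype.val hxy
    ext
    simpa using this
  tw {ρ σ τ} a b := ⟨c.h a * c.h b * (c.h (X.comp a b))⁻¹, c.tw_mem a b⟩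
  tw_conj a b g := by
    ext
    simp [mul_assoc]
  cocycle a b d := by
    ext
    simp [mul_assoc, X.comp_assoc]

end Action.Quot.Choice

end Scwol

namespace ComplexOfGroups

/-- A morphism of complexes of groups over a morphism `f` of scwols, with local homomorphisms
`loc σ` and edge elements `el a`. -/
structure Hom {X : Scwol.{u, v}} {Y : Scwol.{u', v'}} (𝕏 : ComplexOfGroups.{u, v, w} X)
    (𝕐 : ComplexOfGroups.{u', v', w'} Y) where
  f : Scwol.Hom X Y
  loc : ∀ σ : X.V, 𝕏.G σ →* 𝕐.G (f.onV σ)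
  el : ∀ {σ τ : X.V}, X.Edge σ τ → 𝕐.G (f.onV τ)
  conj_el : ∀ {σ τ : X.V} (a : X.Edge σ τ) (g : 𝕏.G σ),
    el a * 𝕐.ψ (f.onE a) (loc σ g) * (el a)⁻¹ = loc τ (𝕏.ψ a g)
  el_comp : ∀ {ρ σ τ : X.V} (a : X.Edge σ τ) (b : X.Edge ρ σ),
    loc τ (𝕏.tw a b) * el (X.comp a b) =
      el a * 𝕐.ψ (f.onE a) (el b) * 𝕐.tw (f.onE a) (f.onE b)

/-- A morphism of complexes of groups is an isomorphism if the underlying morphism of scwols and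
all local homomorphisms are. -/
def Hom.IsIso {X : Scwol.{u, v}} {Y : Scwol.{u', v'}} {𝕏 : ComplexOfGroups.{u, v, w} X}
    {𝕐 : ComplexOfGroups.{u', v', w'} Y} (φ : Hom 𝕏 𝕐) : Prop :=
  φ.f.IsIso ∧ ∀ σ : X.V, Function.Bijective (φ.loc σ)

/-- A complex of groups is developable if it is isomorphic to the complex of groups associated
with an action of a group on a scwol. -/
def Developable {X : Scwol.{u, v}} (𝕏 : ComplexOfGroups.{u, v, w} X) : Prop :=
  ∃ (Γ : Type (max u v w)) (_ : Group Γ) (Z : Scwol.{max u v w, max u v w})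
    (A : Scwol.Action Γ Z) (q : A.Quot X) (c : q.Choice) (φ : Hom 𝕏 c.complex), φ.IsIso

/-- For an edge `y` of `Y` terminating at `f(σ)`, the map from the disjoint union, over the
edges `a` over `y` terminating at `σ`, of the coset spaces `G_σ / ψ_a(G_{i(a)})` to the coset space
`G_{f(σ)} / ψ_y(G_{i(y)})` which sends the coset of `g` to the coset of `φ_σ(g) φ(a)`. -/
def Hom.cosetMap {X : Scwol.{u, v}} {Y : Scwol.{u', v'}} {𝕏 : ComplexOfGroups.{u, v, w} X}
    {𝕐 : ComplexOfGroups.{u', v', w'} Y} (φ : Hom 𝕏 𝕐) (σ : X.V) (y : Y.InEdges (φ.f.onV σ)) :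
    (Σ x : {x : X.InEdges σ // φ.f.onIn x = y}, 𝕏.G σ ⧸ (𝕏.ψ x.1.2).range) →
      𝕐.G (φ.f.onV σ) ⧸ (𝕐.ψ y.2).range :=
  fun z => Quotient.lift
    (fun g : 𝕏.G σ => (QuotientGroup.mk (φ.loc σ g * φ.el z.1.1.2) :
      𝕐.G (φ.f.onV σ) ⧸ (𝕐.ψ y.2).range))
    (by
      obtain ⟨⟨⟨ρ, a⟩, rfl⟩, -⟩ := z
      intro g g' hgg
      obtain ⟨k, hk⟩ := QuotientGroup.leftRel_apply.1 hgg
      refine QuotientGroup.eq.2 ⟨φ.loc ρ k, ?_⟩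
      have h1 : g' = g * 𝕏.ψ a k := by
        rw [hk]; simp
      have h2 := φ.conj_el a k
      change 𝕐.ψ (φ.f.onE a) (φ.loc ρ k) = _
      simp only [h1, map_mul, ← h2]
      group) z.2

/-- Coverings of complexes of groups. -/
structure Hom.IsCovering {X : Scwol.{u, v}} {Y : Scwol.{u', v'}} {𝕏 : ComplexOfGroups.{u, v, w} X}
    {𝕐 : ComplexOfGroups.{u', v', w'} Y} (φ : Hom 𝕏 𝕐) : Prop where
  surjective : φ.f.IsSurjective
  loc_injective : ∀ σ : X.V, Function.Injective (φ.loc σ)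
  cosetMap_bijective : ∀ (σ : X.V) (y : Y.InEdges (φ.f.onV σ)),
    Function.Bijective (φ.cosetMap σ y)

/-- The paths `(g₀, e₁, g₁, …, e_k, g_k)` in a complex of groups, by initial and terminal
vertex. -/
inductive XPath {X : Scwol.{u, v}} (𝕏 : ComplexOfGroups.{u, v, w} X) :
    X.V → X.V → Type (max u v w)
  | nil {σ : X.V} (g : 𝕏.G σ) : XPath 𝕏 σ σ
  | cons {σ τ ρ : X.V} (g : 𝕏.G σ) (e : X.OEdge σ τ) (p : XPath 𝕏 τ ρ) : XPath 𝕏 σ ρ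

namespace XPath

variable {X : Scwol.{u, v}} {𝕏 : ComplexOfGroups.{u, v, w} X}

/-- The path `(g, e, h)`. -/
def seg {σ τ : X.V} (g : 𝕏.G σ) (e : X.OEdge σ τ) (h : 𝕏.G τ) : XPath 𝕏 σ τ := cons g e (nil h)

/-- Multiplication of the first group element of a path by `g` from the left. -/
def lmul : {σ τ : X.V} → 𝕏.G σ → XPath 𝕏 σ τ → XPath 𝕏 σ τ
  | _, _, g, nil h => nil (g * h)
  | _, _, g, cons h e p => cons (g * h) e p

/-- Concatenation of paths. -/
def append : {σ τ ρ : X.V} → XPath 𝕏 σ τ → XPath 𝕏 τ ρ → XPath 𝕏 σ ρ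
  | _, _, _, nil g, q => lmul g q
  | _, _, _, cons g e p, q => cons g e (append p q)

/-- The inverse path. -/
def inv : {σ τ : X.V} → XPath 𝕏 σ τ → XPath 𝕏 τ σ
  | _, _, nil g => nil g⁻¹
  | _, _, cons g e p => append (inv p) (seg 1 e.swap g⁻¹)

/-- The moves on paths: edge slides, reductions, shortcuts. -/
inductive Move : ∀ {σ τ : X.V}, XPath 𝕏 σ τ → XPath 𝕏 σ τ → Prop
  | slide {σ τ : X.V} (a : X.Edge σ τ) (k g : 𝕏.G σ) (h : 𝕏.G τ) :
      Move (seg (k * g) (Sum.inl a) h) (seg k (Sum.inl a) (𝕏.ψ a g * h))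
  | slideInv {σ τ : X.V} (a : X.Edge σ τ) (g : 𝕏.G τ) (h k : 𝕏.G σ) :
      Move (seg g (Sum.inr a) (h * k)) (seg (g * 𝕏.ψ a h) (Sum.inr a) k)
  | reduce {σ τ : X.V} (a : X.Edge σ τ) (g h k : 𝕏.G σ) :
      Move (cons g (Sum.inl a) (seg (𝕏.ψ a h) (Sum.inr a) k)) (nil (g * h * k))
  | reduceInv {σ τ : X.V} (b : X.Edge σ τ) (g k : 𝕏.G τ) (h : 𝕏.G σ) :
      Move (cons g (Sum.inr b) (seg h (Sum.inl b) k)) (nil (g * 𝕏.ψ b h * k))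
  | shortcut {ρ σ τ : X.V} (a : X.Edge σ τ) (b : X.Edge ρ σ) (g : 𝕏.G ρ) (k : 𝕏.G τ) :
      Move (cons g (Sum.inl b) (seg 1 (Sum.inl a) k))
        (seg g (Sum.inl (X.comp a b)) ((𝕏.tw a b)⁻¹ * k))
  | shortcutInv {ρ σ τ : X.V} (a : X.Edge σ τ) (b : X.Edge ρ σ) (g : 𝕏.G τ) (k : 𝕏.G ρ) :
      Move (cons g (Sum.inr a) (seg 1 (Sum.inr b) k))
        (seg (g * 𝕏.tw a b) (Sum.inr (X.comp a b)) k)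

/-- A move applied to a subpath. -/
inductive Elem : ∀ {σ τ : X.V}, XPath 𝕏 σ τ → XPath 𝕏 σ τ → Prop
  | mk {ρ σ τ π : X.V} (l : XPath 𝕏 ρ σ) {s s' : XPath 𝕏 σ τ} (h : Move s s')
      (r : XPath 𝕏 τ π) : Elem (append (append l s) r) (append (append l s') r)

/-- Homotopy of paths: the equivalence relation generated by the moves on subpaths. -/
def Homotopic {σ τ : X.V} (p q : XPath 𝕏 σ τ) : Prop := Relation.EqvGen Elem p q

theorem lmul_lmul {σ τ : X.V} (g h : 𝕏.G σ) (p : XPath 𝕏 σ τ) :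
    lmul g (lmul h p) = lmul (g * h) p := by
  cases p <;> simp [lmul, mul_assoc]

theorem lmul_cons {σ τ ρ : X.V} (g h : 𝕏.G σ) (e : X.OEdge σ τ) (p : XPath 𝕏 τ ρ) :
    lmul g (cons h e p) = cons (g * h) e p := rfl

theorem one_lmul {σ τ : X.V} (p : XPath 𝕏 σ τ) : lmul 1 p = p := by
  cases p <;> simp [lmul]

theorem lmul_append {σ τ ρ : X.V} (g : 𝕏.G σ) (p : XPath 𝕏 σ τ) (q : XPath 𝕏 τ ρ) :
    append (lmul g p) q = lmul g (append p q) := by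
  cases p with
  | nil h => exact (lmul_lmul g h q).symm
  | cons h e p => rfl

theorem append_assoc {σ τ ρ π : X.V} (p : XPath 𝕏 σ τ) (q : XPath 𝕏 τ ρ) (r : XPath 𝕏 ρ π) :
    append (append p q) r = append p (append q r) := by
  induction p with
  | nil g => simp [append, lmul_append]
  | cons g e p ih => simp [append, ih]

theorem append_one {σ τ : X.V} (p : XPath 𝕏 σ τ) : append p (nil 1) = p := by
  induction p with
  | nil g => simp [append, lmul]
  | cons g e p ih => simp [append, ih]

theorem append_seg {σ τ ρ : X.V} (p : XPath 𝕏 σ τ) (g : 𝕏.G τ) (e : X.OEdge τ ρ) (h : 𝕏.G ρ) :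
    append p (seg g e h) = append (append p (nil g)) (seg 1 e h) := by
  rw [append_assoc]; simp [append, seg, lmul]

theorem Homotopic.refl {σ τ : X.V} (p : XPath 𝕏 σ τ) : Homotopic p p := Relation.EqvGen.refl _

theorem Homotopic.symm {σ τ : X.V} {p q : XPath 𝕏 σ τ} (h : Homotopic p q) : Homotopic q p :=
  Relation.EqvGen.symm _ _ h

theorem Homotopic.trans {σ τ : X.V} {p q r : XPath 𝕏 σ τ} (h : Homotopic p q)
    (h' : Homotopic q r) : Homotopic p r := Relation.EqvGen.trans _ _ _ h h'

theorem Homotopic.sandwich {ρ σ τ π : X.V} (l : XPath 𝕏 ρ σ) {p q : XPath 𝕏 σ τ}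
    (h : Homotopic p q) (r : XPath 𝕏 τ π) :
    Homotopic (append (append l p) r) (append (append l q) r) := by
  induction h with
  | refl _ => exact Homotopic.refl _
  | symm _ _ _ ih => exact Homotopic.symm ih
  | trans _ _ _ _ _ ih ih' => exact Homotopic.trans ih ih'
  | rel p q h =>
    obtain ⟨l', h, r'⟩ := h
    have := Elem.mk (append l l') h (append r' r)
    simp only [append_assoc] at this ⊢
    exact Relation.EqvGen.rel _ _ this

theorem Homotopic.append_left {ρ σ τ : X.V} (l : XPath 𝕏 ρ σ) {p q : XPath 𝕏 σ τ}
    (h : Homotopic p q) : Homotopic (append l p) (append l q) := by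
  simpa [append_one] using h.sandwich l (nil 1)

theorem Homotopic.append_right {σ τ π : X.V} {p q : XPath 𝕏 σ τ}
    (h : Homotopic p q) (r : XPath 𝕏 τ π) : Homotopic (append p r) (append q r) := by
  simpa [append, one_lmul] using h.sandwich (nil 1) r

theorem Homotopic.append {ρ σ τ : X.V} {p q : XPath 𝕏 ρ σ} {p' q' : XPath 𝕏 σ τ}
    (h : Homotopic p q) (h' : Homotopic p' q') : Homotopic (p.append p') (q.append q') :=
  (h.append_right p').trans (h'.append_left q)

theorem Move.homotopic {σ τ : X.V} {p q : XPath 𝕏 σ τ} (h : Move p q) : Homotopic p q := by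
  have := Elem.mk (nil 1) h (nil 1)
  simp only [append_one] at this
  simp only [XPath.append, one_lmul] at this
  exact Relation.EqvGen.rel _ _ this

theorem seg_append_swap {σ τ : X.V} (e : X.OEdge σ τ) (g k : 𝕏.G σ) :
    Homotopic (append (seg g e 1) (seg 1 e.swap k)) (nil (g * k)) := by
  cases e with
  | inl a => simpa [append, seg, lmul] using (Move.reduce a g 1 k).homotopic
  | inr a => simpa [append, seg, lmul] using (Move.reduceInv a g k 1).homotopic

theorem append_inv {σ τ : X.V} (p : XPath 𝕏 σ τ) : Homotopic (append p (inv p)) (nil 1) := by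
  induction p with
  | nil g => simpa [append, inv, lmul] using Homotopic.refl _
  | cons g e p ih =>
    have h1 : append (cons g e p) (inv (cons g e p)) =
        append (append (seg g e 1) (append p (inv p))) (seg 1 e.swap g⁻¹) := by
      simp [append, inv, seg, append_assoc, one_lmul]
    rw [h1]
    refine (ih.sandwich _ _).trans ?_
    rw [append_one]
    simpa using seg_append_swap e g g⁻¹

theorem inv_append {σ τ : X.V} (p : XPath 𝕏 σ τ) : Homotopic (append (inv p) p) (nil 1) := by
  induction p with
  | nil g => simpa [append, inv, lmul] using Homotopic.refl _
  | cons g e p ih =>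
    have h1 : append (inv (cons g e p)) (cons g e p) =
        append (append (inv p) (append (seg 1 e.swap 1) (seg 1 e.swap.swap 1))) p := by
      simp [append, inv, seg, append_assoc, one_lmul, lmul_cons]
    rw [h1]
    refine ((seg_append_swap e.swap 1 1).sandwich _ _).trans ?_
    simpa [append_one] using ih

variable (𝕏) in
/-- Homotopy as a setoid. -/
def homotopySetoid (σ τ : X.V) : Setoid (XPath 𝕏 σ τ) :=
  ⟨Homotopic, Homotopic.refl, Homotopic.symm, Homotopic.trans⟩

/-- The relation on paths issuing from `σ₀` with a common terminal vertex: `q` is homotopic to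
the concatenation of `p` with `(g)`, for some `g` in the local group at the terminal vertex. -/
def Equivalent {σ₀ τ : X.V} (p q : XPath 𝕏 σ₀ τ) : Prop :=
  ∃ g : 𝕏.G τ, Homotopic q (append p (nil g))

theorem Homotopic.equivalent {σ₀ τ : X.V} {p q : XPath 𝕏 σ₀ τ} (h : Homotopic p q) :
    Equivalent p q := ⟨1, by rw [append_one]; exact h.symm⟩

theorem Equivalent.symm {σ₀ τ : X.V} {p q : XPath 𝕏 σ₀ τ} (h : Equivalent p q) :
    Equivalent q p := by
  obtain ⟨g, hg⟩ := h
  refine ⟨g⁻¹, ?_⟩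
  have h1 := (hg.append_right (nil g⁻¹)).symm
  rw [append_assoc] at h1
  simpa [append, lmul, append_one] using h1

theorem Equivalent.trans {σ₀ τ : X.V} {p q r : XPath 𝕏 σ₀ τ} (h : Equivalent p q)
    (h' : Equivalent q r) : Equivalent p r := by
  obtain ⟨g, hg⟩ := h
  obtain ⟨k, hk⟩ := h'
  refine ⟨g * k, hk.trans ?_⟩
  have := hg.append_right (nil k)
  rwa [append_assoc] at this

variable (𝕏) in
/-- The relation `Equivalent` as a setoid. -/
def equivalentSetoid (σ₀ τ : X.V) : Setoid (XPath 𝕏 σ₀ τ) :=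
  ⟨Equivalent, fun p => (Homotopic.refl p).equivalent, Equivalent.symm, Equivalent.trans⟩

theorem Equivalent.append_left {σ₁ σ₀ τ : X.V} {l l' : XPath 𝕏 σ₁ σ₀} (hl : Homotopic l l')
    {p q : XPath 𝕏 σ₀ τ} (h : Equivalent p q) : Equivalent (append l p) (append l' q) := by
  obtain ⟨g, hg⟩ := h
  refine ⟨g, ?_⟩
  rw [append_assoc]
  exact hl.symm.append hg

theorem Equivalent.append_edge {σ₀ τ ρ : X.V} (a : X.Edge τ ρ) {p q : XPath 𝕏 σ₀ τ}
    (h : Equivalent p q) :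
    Equivalent (append p (seg 1 (Sum.inl a) 1)) (append q (seg 1 (Sum.inl a) 1)) := by
  obtain ⟨g, hg⟩ := h
  refine ⟨𝕏.ψ a g, (hg.append_right _).trans ?_⟩
  rw [append_assoc, append_assoc]
  refine Homotopic.append_left p ?_
  simpa [append, seg, lmul] using (Move.slide a 1 g 1).homotopic

theorem equivalent_comp {σ₀ ρ σ τ : X.V} (p : XPath 𝕏 σ₀ ρ) (a : X.Edge σ τ) (b : X.Edge ρ σ) :
    Equivalent (append p (seg 1 (Sum.inl (X.comp a b)) 1))
      (append (append p (seg 1 (Sum.inl b) 1)) (seg 1 (Sum.inl a) 1)) := by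
  refine ⟨(𝕏.tw a b)⁻¹, ?_⟩
  rw [append_assoc, append_assoc]
  refine Homotopic.append_left p ?_
  simpa [append, seg, lmul] using (Move.shortcut a b 1 1).homotopic

end XPath

variable {X : Scwol.{u, v}} (𝕏 : ComplexOfGroups.{u, v, w} X)

/-- The fundamental group: homotopy classes of loops at `σ₀`. -/
def FundGroup (σ₀ : X.V) : Type (max u v w) := Quotient (XPath.homotopySetoid 𝕏 σ₀ σ₀)

/-- The group structure `[p] * [q] = [p ⋆ q]`. -/
instance (σ₀ : X.V) : Group (𝕏.FundGroup σ₀) where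
  mul := Quotient.map₂ XPath.append (fun _ _ h _ _ h' => XPath.Homotopic.append h h')
  one := Quotient.mk _ (XPath.nil 1)
  inv x := Quotient.map XPath.inv (fun p q h => by
    have h1 := ((XPath.Homotopic.append_right (XPath.Homotopic.append_left p.inv h) q.inv))
    have h2 := (XPath.inv_append p).append_right q.inv
    have h3 := (XPath.append_inv q).append_left p.inv
    rw [← XPath.append_assoc, XPath.append_one] at h3
    simp only [XPath.append, XPath.one_lmul] at h2
    exact (h3.symm.trans h1.symm).trans h2) x
  mul_assoc := by
    rintro ⟨p⟩ ⟨q⟩ ⟨r⟩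
    exact congrArg (Quotient.mk _) (XPath.append_assoc p q r)
  one_mul := by
    rintro ⟨p⟩
    exact congrArg (Quotient.mk _) (XPath.one_lmul p)
  mul_one := by
    rintro ⟨p⟩
    exact congrArg (Quotient.mk _) (XPath.append_one p)
  inv_mul_cancel := by
    rintro ⟨p⟩
    exact Quotient.sound (XPath.inv_append p)

/-- The classes `[p⟩` of paths `p` from `σ₀` to `τ`. -/
def PathClass (σ₀ τ : X.V) : Type (max u v w) := Quotient (XPath.equivalentSetoid 𝕏 σ₀ τ)

/-- The map `[p⟩ ↦ [p ⋆ (1, a, 1)⟩`. -/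
def PathClass.extend {𝕏 : ComplexOfGroups.{u, v, w} X} {σ₀ τ ρ : X.V} (x : 𝕏.PathClass σ₀ τ)
    (a : X.Edge τ ρ) : 𝕏.PathClass σ₀ ρ :=
  Quotient.map (fun p => XPath.append p (XPath.seg 1 (Sum.inl a) 1))
    (fun _ _ h => XPath.Equivalent.append_edge a h) x

theorem PathClass.extend_comp {𝕏 : ComplexOfGroups.{u, v, w} X} {σ₀ ρ σ τ : X.V}
    (x : 𝕏.PathClass σ₀ ρ) (a : X.Edge σ τ) (b : X.Edge ρ σ) :
    x.extend (X.comp a b) = (x.extend b).extend a := by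
  obtain ⟨p⟩ := x
  exact Quotient.sound (XPath.equivalent_comp p a b)

/-- The universal complex. Its vertices are the classes `[p⟩` of paths issuing from `σ₀` (together
with their terminal vertex), its edges are the triples `([p⟩, a, [p ⋆ (1, a, 1)⟩)`, where `a` is an
edge whose initial vertex is the terminal vertex of `p`. -/
def universalComplex (σ₀ : X.V) : Scwol.{max u v w, v} where
  V := Σ τ : X.V, 𝕏.PathClass σ₀ τ
  Edge x y := {a : X.Edge x.1 y.1 // x.2.extend a = y.2}
  comp a b := ⟨X.comp a.1 b.1, by rw [PathClass.extend_comp, b.2, a.2]⟩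
  comp_assoc a b c := Subtype.ext (X.comp_assoc a.1 b.1 c.1)
  no_loops a := X.no_loops a.1

/-- The vertex `[p⟩` of the universal complex. -/
def vertex {𝕏 : ComplexOfGroups.{u, v, w} X} {σ₀ τ : X.V} (p : XPath 𝕏 σ₀ τ) :
    (𝕏.universalComplex σ₀).V := ⟨τ, Quotient.mk _ p⟩

/-- The map `([q], [p⟩) ↦ [q ⋆ p⟩`. -/
def PathClass.translate {𝕏 : ComplexOfGroups.{u, v, w} X} {σ₀ τ : X.V} (g : 𝕏.FundGroup σ₀)
    (x : 𝕏.PathClass σ₀ τ) : 𝕏.PathClass σ₀ τ :=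
  Quotient.map₂ XPath.append (fun _ _ h _ _ h' => XPath.Equivalent.append_left h h') g x

theorem PathClass.translate_extend {𝕏 : ComplexOfGroups.{u, v, w} X} {σ₀ τ ρ : X.V}
    (g : 𝕏.FundGroup σ₀) (x : 𝕏.PathClass σ₀ τ) (a : X.Edge τ ρ) :
    (x.translate g).extend a = (x.extend a).translate g := by
  obtain ⟨q⟩ := g
  obtain ⟨p⟩ := x
  exact congrArg (Quotient.mk _) (XPath.append_assoc q p _)

theorem PathClass.one_translate {𝕏 : ComplexOfGroups.{u, v, w} X} {σ₀ τ : X.V}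
    (x : 𝕏.PathClass σ₀ τ) : x.translate 1 = x := by
  obtain ⟨p⟩ := x
  exact congrArg (Quotient.mk _) (XPath.one_lmul p)

theorem PathClass.mul_translate {𝕏 : ComplexOfGroups.{u, v, w} X} {σ₀ τ : X.V}
    (g h : 𝕏.FundGroup σ₀) (x : 𝕏.PathClass σ₀ τ) :
    x.translate (g * h) = (x.translate h).translate g := by
  obtain ⟨q⟩ := g
  obtain ⟨r⟩ := h
  obtain ⟨p⟩ := x
  exact congrArg (Quotient.mk _) (XPath.append_assoc q r p)

theorem universalComplex_tot_eq {σ₀ τ ρ : X.V} {x x' : 𝕏.PathClass σ₀ τ} {y y' : 𝕏.PathClass σ₀ ρ}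
    (a : X.Edge τ ρ) (h : x.extend a = y) (h' : x'.extend a = y') (hx : x = x') :
    (𝕏.universalComplex σ₀).tot (σ := ⟨τ, x⟩) (τ := ⟨ρ, y⟩) ⟨a, h⟩ =
      (𝕏.universalComplex σ₀).tot (σ := ⟨τ, x'⟩) (τ := ⟨ρ, y'⟩) ⟨a, h'⟩ := by
  subst hx; subst h; subst h'; rfl

/-- The action of the fundamental group on the universal complex:
`[q] • [p⟩ = [q ⋆ p⟩` and `[q] • ([p⟩, a, [p ⋆ (1, a, 1)⟩) = ([q ⋆ p⟩, a, [q ⋆ p ⋆ (1, a, 1)⟩)`. -/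
def universalAction (σ₀ : X.V) :
    Scwol.Action (𝕏.FundGroup σ₀) (𝕏.universalComplex σ₀) where
  onV :=
    { smul := fun g x => ⟨x.1, x.2.translate g⟩
      one_smul := fun x => Sigma.ext rfl (heq_of_eq x.2.one_translate)
      mul_smul := fun g h x => Sigma.ext rfl (heq_of_eq (x.2.mul_translate g h)) }
  onE g x y a := ⟨a.1, (x.2.translate_extend g a.1).trans (congrArg _ a.2)⟩
  one_onE {x y} a := 𝕏.universalComplex_tot_eq a.1 _ a.2 x.2.one_translate
  mul_onE g h {x y} a := 𝕏.universalComplex_tot_eq a.1 _ _ (x.2.mul_translate g h)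
  onE_comp _ _ _ _ _ _ := rfl
  smul_initial_ne_terminal g x y a h := by
    subst h
    exact X.no_loops a.1
  onE_eq_of_fix g x y a h :=
    𝕏.universalComplex_tot_eq a.1 _ a.2 (eq_of_heq (Sigma.mk.inj h).2)

namespace Hom

variable {X : Scwol.{u, v}} {Y : Scwol.{u', v'}} {𝕏 : ComplexOfGroups.{u, v, w} X}
  {𝕐 : ComplexOfGroups.{u', v', w'} Y} (φ : Hom 𝕏 𝕐)

/-- The map on paths which is multiplicative with respect to concatenation and satisfies
`(g) ↦ (φ_σ(g))`, `(1, a, 1) ↦ (1, f(a), φ(a)⁻¹)` and `(1, a⁻¹, 1) ↦ (φ(a), f(a)⁻¹, 1)`. -/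
def onPath : {σ τ : X.V} → XPath 𝕏 σ τ → XPath 𝕐 (φ.f.onV σ) (φ.f.onV τ)
  | _, _, .nil g => .nil (φ.loc _ g)
  | _, _, .cons g (Sum.inl a) p =>
      ((XPath.nil (φ.loc _ g)).append
        (.seg 1 (Sum.inl (φ.f.onE a)) (φ.el a)⁻¹)).append (onPath p)
  | _, _, .cons g (Sum.inr a) p =>
      ((XPath.nil (φ.loc _ g)).append
        (.seg (φ.el a) (Sum.inr (φ.f.onE a)) 1)).append (onPath p)

theorem onPath_lmul {σ τ : X.V} (g : 𝕏.G σ) (p : XPath 𝕏 σ τ) :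
    φ.onPath (p.lmul g) = (φ.onPath p).lmul (φ.loc _ g) := by
  cases p with
  | nil h => simp [XPath.lmul, onPath]
  | cons h e p =>
    rcases e with a | a <;> simp [XPath.lmul, onPath, XPath.append, XPath.seg, mul_assoc]

theorem onPath_append {σ τ ρ : X.V} (p : XPath 𝕏 σ τ) (q : XPath 𝕏 τ ρ) :
    φ.onPath (p.append q) = (φ.onPath p).append (φ.onPath q) := by
  induction p with
  | nil g => simp [XPath.append, onPath, onPath_lmul]
  | cons g e p ih =>
    rcases e with a | a <;> simp [XPath.append, onPath, ih, XPath.append_assoc]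

theorem onPath_move {σ τ : X.V} {p q : XPath 𝕏 σ τ} (h : XPath.Move p q) :
    XPath.Homotopic (φ.onPath p) (φ.onPath q) := by
  cases h with
  | slide a k g h =>
    have := (XPath.Move.slide (φ.f.onE a) (φ.loc _ k) (φ.loc _ g)
      ((φ.el a)⁻¹ * φ.loc _ h)).homotopic
    simpa [onPath, XPath.append, XPath.seg, XPath.lmul, mul_assoc, ← φ.conj_el a g] using this
  | slideInv a g h k =>
    have := (XPath.Move.slideInv (φ.f.onE a) (φ.loc _ g * φ.el a) (φ.loc _ h)
      (φ.loc _ k)).homotopic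
    simpa [onPath, XPath.append, XPath.seg, XPath.lmul, mul_assoc, ← φ.conj_el a h] using this
  | reduce a g h k =>
    have := (XPath.Move.reduce (φ.f.onE a) (φ.loc _ g) (φ.loc _ h) (φ.loc _ k)).homotopic
    simpa [onPath, XPath.append, XPath.seg, XPath.lmul, mul_assoc, ← φ.conj_el a h] using this
  | reduceInv a g k h =>
    have := (XPath.Move.reduceInv (φ.f.onE a) (φ.loc _ g * φ.el a) ((φ.el a)⁻¹ * φ.loc _ k)
      (φ.loc _ h)).homotopic
    simpa [onPath, XPath.append, XPath.seg, XPath.lmul, mul_assoc, ← φ.conj_el a h] using this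
  | shortcut a b g k =>
    have h0 : (φ.el (X.comp a b))⁻¹ * (φ.loc _ (𝕏.tw a b))⁻¹ =
        (𝕐.tw (φ.f.onE a) (φ.f.onE b))⁻¹ *
          ((𝕐.ψ (φ.f.onE a) (φ.el b))⁻¹ * (φ.el a)⁻¹) := by
      rw [← mul_inv_rev, φ.el_comp a b]; simp [mul_assoc]
    have h1 := (XPath.Move.slide (φ.f.onE a) 1 (φ.el b)⁻¹
      ((φ.el a)⁻¹ * φ.loc _ k)).homotopic.append_left
        (XPath.seg (φ.loc _ g) (Sum.inl (φ.f.onE b)) 1)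
    have h2 := (XPath.Move.shortcut (φ.f.onE a) (φ.f.onE b) (φ.loc _ g)
      ((𝕐.ψ (φ.f.onE a) (φ.el b))⁻¹ * ((φ.el a)⁻¹ * φ.loc _ k))).homotopic
    have h0' := congrArg (· * φ.loc _ k) h0
    simp only [mul_assoc] at h0'
    simp only [XPath.append, XPath.seg, XPath.lmul, one_mul, map_inv] at h1
    have h3 := h1.trans h2
    simpa [onPath, XPath.append, XPath.seg, XPath.lmul, φ.f.map_comp, h0'] using h3
  | shortcutInv a b g k =>
    have h0 := φ.el_comp a b
    have h1 := (XPath.Move.slideInv (φ.f.onE a) (φ.loc _ g * φ.el a) (φ.el b)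
      1).homotopic.append_right (XPath.seg 1 (Sum.inr (φ.f.onE b)) (φ.loc _ k))
    have h2 := (XPath.Move.shortcutInv (φ.f.onE a) (φ.f.onE b)
      (φ.loc _ g * φ.el a * 𝕐.ψ (φ.f.onE a) (φ.el b)) (φ.loc _ k)).homotopic
    simp only [XPath.append, XPath.seg, XPath.lmul, mul_one] at h1
    have h3 := h1.trans h2
    simpa [onPath, XPath.append, XPath.seg, XPath.lmul, φ.f.map_comp, mul_assoc, h0] using h3

theorem onPath_homotopic {σ τ : X.V} {p q : XPath 𝕏 σ τ} (h : XPath.Homotopic p q) :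
    XPath.Homotopic (φ.onPath p) (φ.onPath q) := by
  induction h with
  | refl _ => exact XPath.Homotopic.refl _
  | symm _ _ _ ih => exact XPath.Homotopic.symm ih
  | trans _ _ _ _ _ ih ih' => exact XPath.Homotopic.trans ih ih'
  | rel p q h =>
    obtain ⟨l, h, r⟩ := h
    simp only [onPath_append]
    exact (φ.onPath_move h).sandwich _ _

theorem onPath_equivalent {σ τ : X.V} {p q : XPath 𝕏 σ τ} (h : XPath.Equivalent p q) :
    XPath.Equivalent (φ.onPath p) (φ.onPath q) := by
  obtain ⟨g, hg⟩ := h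
  refine ⟨φ.loc _ g, ?_⟩
  simpa [onPath_append, onPath] using φ.onPath_homotopic hg

/-- The homomorphism `[p] ↦ [𝔭_φ(p)]` of fundamental groups. -/
def onFundGroup (σ₀ : X.V) : 𝕏.FundGroup σ₀ →* 𝕐.FundGroup (φ.f.onV σ₀) where
  toFun := Quotient.map φ.onPath (fun _ _ h => φ.onPath_homotopic h)
  map_one' := congrArg (Quotient.mk _) (congrArg XPath.nil (map_one (φ.loc σ₀)))
  map_mul' := by
    rintro ⟨p⟩ ⟨q⟩
    exact congrArg (Quotient.mk _) (φ.onPath_append p q)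

/-- The map `[p⟩ ↦ [𝔭_φ(p)⟩`. -/
def onPathClass {σ₀ τ : X.V} (x : 𝕏.PathClass σ₀ τ) :
    𝕐.PathClass (φ.f.onV σ₀) (φ.f.onV τ) :=
  Quotient.map φ.onPath (fun _ _ h => φ.onPath_equivalent h) x

theorem onPathClass_extend {σ₀ τ ρ : X.V} (x : 𝕏.PathClass σ₀ τ) (a : X.Edge τ ρ) :
    (φ.onPathClass x).extend (φ.f.onE a) = φ.onPathClass (x.extend a) := by
  obtain ⟨p⟩ := x
  refine Quotient.sound ?_
  change XPath.Equivalent _ (φ.onPath _)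
  rw [onPath_append]
  refine ⟨(φ.el a)⁻¹, ?_⟩
  rw [XPath.append_assoc]
  simpa [onPath, XPath.append, XPath.seg, XPath.lmul] using XPath.Homotopic.refl _

/-- The morphism of universal complexes induced by a morphism of complexes of groups:
`[p⟩ ↦ [𝔭_φ(p)⟩` on vertices, and the edge with initial vertex `[p⟩` over `a` is mapped to
the edge with initial vertex `[𝔭_φ(p)⟩` over `f(a)`. -/
def tilde (σ₀ : X.V) :
    Scwol.Hom (𝕏.universalComplex σ₀) (𝕐.universalComplex (φ.f.onV σ₀)) where
  onV x := ⟨φ.f.onV x.1, φ.onPathClass x.2⟩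
  onE {x y} a := ⟨φ.f.onE a.1, (φ.onPathClass_extend x.2 a.1).trans (congrArg _ a.2)⟩
  map_comp a b := Subtype.ext (φ.f.map_comp a.1 b.1)
  star_bijective := by
    rintro ⟨τ, x⟩
    constructor
    · rintro ⟨⟨ρ, y⟩, ⟨a, ha⟩⟩ ⟨⟨ρ', y'⟩, ⟨a', ha'⟩⟩ h
      have h1 : (⟨φ.f.onV ρ, φ.f.onE a⟩ : Y.OutEdges (φ.f.onV τ)) =
          ⟨φ.f.onV ρ', φ.f.onE a'⟩ :=
        congrArg (fun z : (𝕐.universalComplex (φ.f.onV σ₀)).OutEdges ⟨φ.f.onV τ, φ.onPathClass x⟩ =>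
          (⟨z.1.1, z.2.1⟩ : Y.OutEdges (φ.f.onV τ))) h
      have h2 := (φ.f.star_bijective τ).1 (a₁ := ⟨ρ, a⟩) (a₂ := ⟨ρ', a'⟩) h1
      cases h2
      have key : ∀ (z z' : 𝕏.PathClass σ₀ ρ) (hz : x.extend a = z) (hz' : x.extend a = z'),
          (⟨⟨ρ, z⟩, ⟨a, hz⟩⟩ : (𝕏.universalComplex σ₀).OutEdges ⟨τ, x⟩) =
            ⟨⟨ρ, z'⟩, ⟨a, hz'⟩⟩ := by
        intro z z' hz hz'; subst hz; subst hz'; rfl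
      exact key _ _ ha ha'
    · rintro ⟨⟨ρ', y'⟩, ⟨a', ha'⟩⟩
      obtain ⟨⟨ρ, a⟩, h⟩ := (φ.f.star_bijective τ).2 ⟨ρ', a'⟩
      cases h
      refine ⟨⟨⟨ρ, x.extend a⟩, ⟨a, rfl⟩⟩, ?_⟩
      change (φ.onPathClass x).extend (φ.f.onE a) = y' at ha'
      subst ha'
      have h3 := φ.onPathClass_extend x a
      have key : ∀ (z : 𝕐.PathClass (φ.f.onV σ₀) (φ.f.onV ρ))
          (hz : (φ.onPathClass x).extend (φ.f.onE a) = z),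
          (⟨⟨φ.f.onV ρ, z⟩, ⟨φ.f.onE a, hz⟩⟩ :
            (𝕐.universalComplex (φ.f.onV σ₀)).OutEdges ⟨φ.f.onV τ, φ.onPathClass x⟩) =
          ⟨⟨φ.f.onV ρ, (φ.onPathClass x).extend (φ.f.onE a)⟩, ⟨φ.f.onE a, rfl⟩⟩ := by
        intro z hz; subst hz; rfl
      exact key _ h3

end Hom

end ComplexOfGroups

/-- Equivariance, on vertices and on edges, of a morphism of scwols with respect to a homomorphism
of the groups acting on them. -/
def Scwol.Hom.IsEquivariant {Γ : Type w} [Group Γ] {Δ : Type w'} [Group Δ] {Z : Scwol.{u, v}}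
    {W : Scwol.{u', v'}} (F : Scwol.Hom Z W) (A : Scwol.Action Γ Z) (B : Scwol.Action Δ W)
    (θ : Γ →* Δ) : Prop :=
  (∀ (g : Γ) (x : Z.V), F.onV (A.onV.smul g x) = B.onV.smul (θ g) (F.onV x)) ∧
  (∀ (g : Γ) {x y : Z.V} (a : Z.Edge x y),
    W.tot (F.onE (A.onE g a)) = W.tot (B.onE (θ g) (F.onE a)))

/-! The argument is unique path lifting, as for topological coverings. Since a morphism of scwols is
bijective on the edges issuing from each vertex, it is enough that `tilde` be bijective on vertices
(`isIso_of_bijective_onV`).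

For surjectivity, a path `q` in `𝕐` is lifted edge by edge, up to homotopy and a final group element
(`exists_lift_path`). A forward edge lifts because `f` is bijective on outgoing edges; an inverse
edge lifts because the coset map is surjective.

For injectivity, the path groupoid of `𝕐` acts on a family of fibres. A point of `Fibre σ₀ τ` is a
pair `(p, g)`, to be thought of as the path `φ(p) ⋆ (g)`, with `p` an `𝕏`-path from `σ₀` ending over
`τ` and `g` in the local group at `τ`; the pairs `(p ⋆ (k), h)` and `(p, φ(k) h)` are identified.
Local groups act by right multiplication and edges by `cross`, which is bijective exactly because of
the covering condition (`cross_surjective`, `cross_injective`). Each elementary move then becomes an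
identity between these bijections, so transport depends only on the homotopy class of a path
(`transport_homotopic`). Transporting the base point `((1), 1)` along `φ(p)` gives `(p, 1)`
(`transport_onPath`). Hence the vertex of `p` is recovered from that of `φ(p)`, which gives a left
inverse of `tilde` on vertices.

Equivariance is the multiplicativity of `onPath`. -/

theorem Scwol.tot_in {X : Scwol.{u, v}} {σ σ' τ : X.V} {a : X.Edge σ τ} {b : X.Edge σ' τ}
    (h : X.tot a = X.tot b) : (⟨σ, a⟩ : X.InEdges τ) = ⟨σ', b⟩ := by
  cases h; rfl

/-! ### Isomorphisms of scwols and lifts of edges. -/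

namespace Scwol.Hom

variable {X : Scwol.{u, v}} {Y : Scwol.{u', v'}}

/-- A morphism of scwols which is bijective on vertices is an isomorphism. -/
theorem isIso_of_bijective_onV (f : Hom X Y) (hf : Function.Bijective f.onV) : f.IsIso := by
  refine ⟨hf, ?_, ?_⟩
  · rintro ⟨σ, τ, a⟩ ⟨σ', τ', a'⟩ h
    -- Equal images have equal initial vertices; injectivity on vertices puts both edges in one
    -- star.
    have h0 : σ = σ' := hf.1 (tot_initial h)
    subst h0
    exact f.eq_of_tot h
  · rintro ⟨σ', τ', a'⟩
    obtain ⟨σ, rfl⟩ := hf.2 σ'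
    obtain ⟨⟨τ, a⟩, h⟩ := (f.star_bijective σ).2 ⟨τ', a'⟩
    cases h
    exact ⟨⟨σ, τ, a⟩, rfl⟩

/-- Edges lift, once a lift of the initial vertex is given. -/
theorem exists_lift_edge (f : Hom X Y) {σ : X.V} {ρ τ : Y.V} (hσ : f.onV σ = ρ)
    (a : Y.Edge ρ τ) : ∃ x : X.OutEdges σ, Y.tot (f.onE x.2) = Y.tot a := by
  subst hσ
  obtain ⟨⟨τ', a'⟩, h⟩ := (f.star_bijective σ).2 ⟨τ, a⟩
  cases h
  exact ⟨⟨τ', a'⟩, rfl⟩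

end Scwol.Hom

/-! ### Homotopies of paths prolonged by an edge. -/

namespace ComplexOfGroups

namespace XPath

variable {X : Scwol.{u, v}} {𝕏 : ComplexOfGroups.{u, v, w} X}

theorem lmul_nil {σ : X.V} (g h : 𝕏.G σ) : lmul g (nil h) = nil (g * h) := rfl

/-- Going back along `e` undoes the prolongation up to homotopy. -/
theorem append_edge_cancel {σ₀ σ τ : X.V} {p q : XPath 𝕏 σ₀ σ} (e : X.OEdge σ τ)
    (h : Homotopic (append p (seg 1 e 1)) (append q (seg 1 e 1))) : Homotopic p q := by
  have key : ∀ r : XPath 𝕏 σ₀ σ,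
      Homotopic (append (append r (seg 1 e 1)) (seg 1 e.swap 1)) r := fun r => by
    have := (seg_append_swap (𝕏 := 𝕏) e 1 1).append_left r
    rw [append_assoc]
    simpa [append_one] using this
  exact (key p).symm.trans ((h.append_right _).trans (key q))

theorem append_slide {σ₀ σ τ : X.V} (p : XPath 𝕏 σ₀ σ) (a : X.Edge σ τ) (k : 𝕏.G σ) :
    Homotopic (append (append p (nil k)) (seg 1 (Sum.inl a) 1))
      (append (append p (seg 1 (Sum.inl a) 1)) (nil (𝕏.ψ a k))) := by
  rw [append_assoc, append_assoc]
  refine Homotopic.append_left p ?_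
  simpa [append, seg, lmul] using (Move.slide a 1 k 1).homotopic

end XPath

/-! ### The fibres over the vertices of `Y`. -/

namespace Hom

variable {X : Scwol.{u, v}} {Y : Scwol.{u', v'}} {𝕏 : ComplexOfGroups.{u, v, w} X}
  {𝕐 : ComplexOfGroups.{u', v', w'} Y} (φ : Hom 𝕏 𝕐)

/-- The local homomorphism at a vertex `σ` over `τ`. -/
def locOver {σ : X.V} {τ : Y.V} (h : φ.f.onV σ = τ) : 𝕏.G σ →* 𝕐.G τ := h ▸ φ.loc σ

/-- The element attached to an edge which ends over `τ`. -/
def elOver {ρ σ : X.V} {τ : Y.V} (a : X.Edge ρ σ) (h : φ.f.onV σ = τ) : 𝕐.G τ := h ▸ φ.el a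

/-- This is `conj_el` for a lift `a` of a given edge `a'`, whose endpoints agree with those of
`f(a)` only propositionally; it makes `cross` well defined. -/
theorem elOver_mul_ψ {ρ σ : X.V} {ρ' σ' : Y.V} {a : X.Edge ρ σ} {a' : Y.Edge ρ' σ'}
    (h : Y.tot (φ.f.onE a) = Y.tot a') (hρ : φ.f.onV ρ = ρ') (hσ : φ.f.onV σ = σ') (g : 𝕏.G ρ) :
    φ.elOver a hσ * 𝕐.ψ a' (φ.locOver hρ g) = φ.locOver hσ (𝕏.ψ a g) * φ.elOver a hσ := by
  cases h
  change φ.el a * 𝕐.ψ (φ.f.onE a) (φ.loc ρ g) = φ.loc σ (𝕏.ψ a g) * φ.el a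
  rw [← φ.conj_el a g, inv_mul_cancel_right]

theorem elOver_comp {ρ σ τ : X.V} {ρ' σ' τ' : Y.V} {a : X.Edge σ τ} {b : X.Edge ρ σ}
    {a' : Y.Edge σ' τ'} {b' : Y.Edge ρ' σ'} (ha : Y.tot (φ.f.onE a) = Y.tot a')
    (hb : Y.tot (φ.f.onE b) = Y.tot b') (hσ : φ.f.onV σ = σ') (hτ : φ.f.onV τ = τ') :
    φ.locOver hτ (𝕏.tw a b) * φ.elOver (X.comp a b) hτ =
      φ.elOver a hτ * 𝕐.ψ a' (φ.elOver b hσ) * 𝕐.tw a' b' := by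
  cases ha
  cases hb
  exact φ.el_comp a b

/-- A path issuing from `σ₀` and ending over `τ`, with an element of the local group at `τ`. -/
structure LiftedPath (σ₀ : X.V) (τ : Y.V) where
  vtx : X.V
  vtx_over : φ.f.onV vtx = τ
  path : XPath 𝕏 σ₀ vtx
  elt : 𝕐.G τ

variable {φ}

/-- The identification of `(p ⋆ (k), h)` with `(p, φ(k) h)`. -/
inductive LiftedPath.Rel {σ₀ : X.V} {τ : Y.V} : φ.LiftedPath σ₀ τ → φ.LiftedPath σ₀ τ → Prop
  | intro (σ : X.V) (hσ : φ.f.onV σ = τ) (p q : XPath 𝕏 σ₀ σ) (g h : 𝕐.G τ) (k : 𝕏.G σ)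
      (hp : XPath.Homotopic p (q.append (.nil k))) (hg : h = φ.locOver hσ k * g) :
      Rel ⟨σ, hσ, p, g⟩ ⟨σ, hσ, q, h⟩

theorem LiftedPath.Rel.refl {σ₀ : X.V} {τ : Y.V} (x : φ.LiftedPath σ₀ τ) : Rel x x :=
  ⟨x.vtx, x.vtx_over, x.path, x.path, x.elt, x.elt, 1,
    by rw [XPath.append_one]; exact XPath.Homotopic.refl _, by simp⟩

theorem LiftedPath.Rel.symm {σ₀ : X.V} {τ : Y.V} {x y : φ.LiftedPath σ₀ τ} (h : Rel x y) :
    Rel y x := by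
  obtain ⟨σ, hσ, p, q, g, h, k, hp, rfl⟩ := h
  refine ⟨σ, hσ, q, p, _, g, k⁻¹, ?_, by simp⟩
  have h1 := (hp.append_right (.nil k⁻¹)).symm
  rw [XPath.append_assoc] at h1
  simpa [XPath.append, XPath.lmul, XPath.append_one] using h1

theorem LiftedPath.Rel.trans {σ₀ : X.V} {τ : Y.V} {x y z : φ.LiftedPath σ₀ τ} (h : Rel x y)
    (h' : Rel y z) : Rel x z := by
  obtain ⟨σ, hσ, p, q, g, h, k, hp, rfl⟩ := h
  obtain ⟨_, _, _, r, _, h', k', hq, rfl⟩ := h'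
  refine ⟨σ, hσ, p, r, g, _, k' * k, ?_, by simp [mul_assoc]⟩
  refine hp.trans ?_
  have := hq.append_right (.nil k)
  rwa [XPath.append_assoc] at this

variable (φ) in
/-- The relation `LiftedPath.Rel` as a setoid. -/
def liftedSetoid (σ₀ : X.V) (τ : Y.V) : Setoid (φ.LiftedPath σ₀ τ) :=
  ⟨LiftedPath.Rel, LiftedPath.Rel.refl, LiftedPath.Rel.symm, LiftedPath.Rel.trans⟩

variable (φ) in
/-- The fibre over `τ` of the covering of the path groupoid of `𝕐` determined by `φ` and `σ₀`. -/
def Fibre (σ₀ : X.V) (τ : Y.V) := Quotient (φ.liftedSetoid σ₀ τ)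

namespace Fibre

variable {σ₀ : X.V}

/-- The class of `(p, g)`. -/
def mk {σ : X.V} {τ : Y.V} (hσ : φ.f.onV σ = τ) (p : XPath 𝕏 σ₀ σ) (g : 𝕐.G τ) :
    φ.Fibre σ₀ τ := Quotient.mk _ ⟨σ, hσ, p, g⟩

theorem exists_mk {τ : Y.V} (x : φ.Fibre σ₀ τ) :
    ∃ (σ : X.V) (hσ : φ.f.onV σ = τ) (p : XPath 𝕏 σ₀ σ) (g : 𝕐.G τ), x = mk hσ p g := by
  obtain ⟨σ, hσ, p, g⟩ := x
  exact ⟨σ, hσ, p, g, rfl⟩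

theorem mk_eq {σ : X.V} {τ : Y.V} (hσ : φ.f.onV σ = τ) {p q : XPath 𝕏 σ₀ σ} {g h : 𝕐.G τ}
    (k : 𝕏.G σ) (hp : XPath.Homotopic p (q.append (.nil k))) (hg : h = φ.locOver hσ k * g) :
    mk hσ p g = mk hσ q h :=
  Quotient.sound (LiftedPath.Rel.intro σ hσ p q g h k hp hg)

/-- Right multiplication by an element of the local group. -/
def rmul {τ : Y.V} (x : φ.Fibre σ₀ τ) (g : 𝕐.G τ) : φ.Fibre σ₀ τ :=
  Quotient.map (fun y : φ.LiftedPath σ₀ τ => ⟨y.vtx, y.vtx_over, y.path, y.elt * g⟩) (by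
    rintro _ _ ⟨σ, hσ, p, q, h, h', k, hp, rfl⟩
    exact ⟨σ, hσ, p, q, _, _, k, hp, mul_assoc _ _ _⟩) x

theorem mk_rmul {σ : X.V} {τ : Y.V} (hσ : φ.f.onV σ = τ) (p : XPath 𝕏 σ₀ σ) (g h : 𝕐.G τ) :
    (mk hσ p g).rmul h = mk hσ p (g * h) := rfl

theorem rmul_rmul {τ : Y.V} (x : φ.Fibre σ₀ τ) (g h : 𝕐.G τ) :
    (x.rmul g).rmul h = x.rmul (g * h) := by
  obtain ⟨σ, hσ, p, k, rfl⟩ := x.exists_mk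
  simp only [mk_rmul, mul_assoc]

theorem rmul_one {τ : Y.V} (x : φ.Fibre σ₀ τ) : x.rmul 1 = x := by
  obtain ⟨σ, hσ, p, k, rfl⟩ := x.exists_mk
  simp only [mk_rmul, mul_one]

/-! ### Transport along an edge. -/

/-- Prolongation of a lifted path along the lift of an edge. -/
noncomputable def crossLifted {ρ τ : Y.V} (a : Y.Edge ρ τ) (x : φ.LiftedPath σ₀ ρ) :
    φ.LiftedPath σ₀ τ :=
  let e := φ.f.exists_lift_edge x.vtx_over a
  ⟨e.choose.1, Scwol.tot_terminal e.choose_spec,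
    x.path.append (.seg 1 (Sum.inl e.choose.2) 1),
    -- Sliding `g` across `a` gives `ψ_a(g)`; the factor `φ(a')` compensates the `φ(a')⁻¹` with
    -- which `onPath` ends the image of the lifted edge `a'`.
    φ.elOver e.choose.2 (Scwol.tot_terminal e.choose_spec) * 𝕐.ψ a x.elt⟩

/-- Transport along an edge. -/
noncomputable def cross {ρ τ : Y.V} (a : Y.Edge ρ τ) (x : φ.Fibre σ₀ ρ) : φ.Fibre σ₀ τ :=
  Quotient.map (crossLifted a) (by
    rintro _ _ ⟨σ, hσ, p, q, g, h, k, hp, rfl⟩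
    -- The element `k` relating the two representatives becomes `ψ(k)` after sliding across the
    -- lifted edge.
    refine ⟨_, _, _, _, _, _, 𝕏.ψ (φ.f.exists_lift_edge hσ a).choose.2 k,
      (hp.append_right _).trans (XPath.append_slide q _ k), ?_⟩
    rw [← mul_assoc, ← φ.elOver_mul_ψ (φ.f.exists_lift_edge hσ a).choose_spec hσ, map_mul,
      mul_assoc]) x

/-- Frees `cross` from the chosen lift: two lifts of `a` issuing from the same vertex coincide. -/
theorem cross_mk {ρ τ : Y.V} {σ σ' : X.V} {a : Y.Edge ρ τ} {a' : X.Edge σ σ'}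
    (ha : Y.tot (φ.f.onE a') = Y.tot a) (hσ : φ.f.onV σ = ρ) (p : XPath 𝕏 σ₀ σ) (g : 𝕐.G ρ) :
    cross a (mk hσ p g) = mk (Scwol.tot_terminal ha) (p.append (.seg 1 (Sum.inl a') 1))
      (φ.elOver a' (Scwol.tot_terminal ha) * 𝕐.ψ a g) := by
  have key : ∀ (e e' : X.OutEdges σ) (h : Y.tot (φ.f.onE e.2) = Y.tot a)
      (h' : Y.tot (φ.f.onE e'.2) = Y.tot a),
      (⟨e.1, Scwol.tot_terminal h, p.append (.seg 1 (Sum.inl e.2) 1),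
        φ.elOver e.2 (Scwol.tot_terminal h) * 𝕐.ψ a g⟩ : φ.LiftedPath σ₀ τ) =
      ⟨e'.1, Scwol.tot_terminal h', p.append (.seg 1 (Sum.inl e'.2) 1),
        φ.elOver e'.2 (Scwol.tot_terminal h') * 𝕐.ψ a g⟩ := by
    rintro ⟨_, _⟩ ⟨_, _⟩ h h'
    cases φ.f.eq_of_tot (h.trans h'.symm)
    rfl
  exact congrArg (Quotient.mk _) (key _ ⟨σ', a'⟩ (φ.f.exists_lift_edge hσ a).choose_spec ha)

theorem cross_rmul {ρ τ : Y.V} (a : Y.Edge ρ τ) (x : φ.Fibre σ₀ ρ) (g : 𝕐.G ρ) :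
    cross a (x.rmul g) = (cross a x).rmul (𝕐.ψ a g) := by
  obtain ⟨σ, hσ, p, h, rfl⟩ := x.exists_mk
  obtain ⟨⟨σ', a'⟩, ha⟩ := φ.f.exists_lift_edge hσ a
  rw [mk_rmul, cross_mk ha, cross_mk ha, mk_rmul, map_mul, mul_assoc]

/-- The shortcut move in `𝕏` costs `(𝕏.tw a' b')⁻¹`, and `el_comp` converts its image into the
twisting element of `𝕐`. -/
theorem cross_cross {ρ σ τ : Y.V} (a : Y.Edge σ τ) (b : Y.Edge ρ σ) (x : φ.Fibre σ₀ ρ) :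
    cross a (cross b x) = (cross (Y.comp a b) x).rmul (𝕐.tw a b)⁻¹ := by
  obtain ⟨ρ', hρ, p, h, rfl⟩ := x.exists_mk
  obtain ⟨⟨σ', b'⟩, hb⟩ := φ.f.exists_lift_edge hρ b
  have hσ := Scwol.tot_terminal hb
  obtain ⟨⟨τ', a'⟩, ha⟩ := φ.f.exists_lift_edge hσ a
  have hτ := Scwol.tot_terminal ha
  have hab : Y.tot (φ.f.onE (X.comp a' b')) = Y.tot (Y.comp a b) := by
    rw [φ.f.map_comp]
    exact Scwol.tot_comp ha hb
  rw [cross_mk hb, cross_mk ha, cross_mk hab, mk_rmul]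
  refine mk_eq _ (𝕏.tw a' b')⁻¹ ?_ ?_
  · rw [XPath.append_assoc, XPath.append_assoc]
    refine XPath.Homotopic.append_left p ?_
    simpa [XPath.append, XPath.seg, XPath.lmul] using (XPath.Move.shortcut a' b' 1 1).homotopic
  · have h1 := φ.elOver_comp ha hb hσ hτ
    rw [map_inv, eq_inv_mul_iff_mul_eq]
    simp only [← mul_assoc, h1, map_mul]
    simp only [← 𝕐.tw_conj a b, mul_assoc]

theorem cross_surjective (hφ : φ.IsCovering) {ρ τ : Y.V} (a : Y.Edge ρ τ) :
    Function.Surjective (cross (φ := φ) (σ₀ := σ₀) a) := by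
  intro x
  obtain ⟨σ, rfl, p, h, rfl⟩ := x.exists_mk
  -- Write `h = φ(g) φ(a') ψ_a(k)`: the coset of `h` selects the lift `a'` along which to go back,
  -- and `k` is what remains.
  obtain ⟨⟨⟨⟨ρ', a'⟩, ha⟩, g⟩, hg⟩ := (hφ.cosetMap_bijective σ ⟨ρ, a⟩).2 (QuotientGroup.mk h)
  cases ha
  obtain ⟨g⟩ := g
  obtain ⟨k, hk⟩ := QuotientGroup.eq.1 hg
  refine ⟨mk rfl (p.append (.seg g (Sum.inr a') 1)) k, ?_⟩
  rw [cross_mk (a' := a') rfl]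
  refine mk_eq _ g ?_ ?_
  · rw [XPath.append_assoc]
    refine XPath.Homotopic.append_left p ?_
    simpa [XPath.append, XPath.seg, XPath.lmul] using (XPath.Move.reduceInv a' g 1 1).homotopic
  · change 𝕐.ψ (φ.f.onE a') k = _ at hk
    rw [hk]
    change h = φ.loc σ g * (φ.el a' * ((φ.loc σ g * φ.el a')⁻¹ * h))
    group

/-- If the images agree, their lifted edges define the same coset, so injectivity of the coset map
identifies these edges and shows that the relating element `k` is some `ψ(j)`. Sliding `j` back
across the edge relates the original pairs. -/
theorem cross_injective (hφ : φ.IsCovering) {ρ τ : Y.V} (a : Y.Edge ρ τ) :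
    Function.Injective (cross (φ := φ) (σ₀ := σ₀) a) := by
  intro x y hxy
  obtain ⟨ρ₁, h₁, p₁, g₁, rfl⟩ := x.exists_mk
  obtain ⟨ρ₂, h₂, p₂, g₂, rfl⟩ := y.exists_mk
  obtain ⟨⟨σ₁, a₁⟩, ha₁⟩ := φ.f.exists_lift_edge h₁ a
  obtain ⟨⟨σ₂, a₂⟩, ha₂⟩ := φ.f.exists_lift_edge h₂ a
  rw [cross_mk ha₁, cross_mk ha₂] at hxy
  have hr : LiftedPath.Rel _ _ := Quotient.exact hxy
  obtain ⟨_, _, _, _, _, _, k, hp, hg⟩ := hr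
  dsimp only at ha₁ ha₂ hp hg
  cases ha₁
  have hin : φ.f.onIn ⟨ρ₂, a₂⟩ = φ.f.onIn ⟨ρ₁, a₁⟩ := Scwol.tot_in ha₂
  have hcos : φ.cosetMap σ₁ _ ⟨⟨⟨ρ₂, a₂⟩, hin⟩, QuotientGroup.mk 1⟩ =
      φ.cosetMap σ₁ _ ⟨⟨⟨ρ₁, a₁⟩, rfl⟩, QuotientGroup.mk k⟩ := by
    change φ.el a₂ * 𝕐.ψ (φ.f.onE a₁) g₂ = φ.loc σ₁ k * (φ.el a₁ * 𝕐.ψ (φ.f.onE a₁) g₁) at hg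
    refine QuotientGroup.eq.2 ⟨g₂ * g₁⁻¹, ?_⟩
    change 𝕐.ψ (φ.f.onE a₁) _ = (φ.loc σ₁ 1 * φ.el a₂)⁻¹ * (φ.loc σ₁ k * φ.el a₁)
    rw [map_one, one_mul, eq_inv_mul_iff_mul_eq, map_mul, ← mul_assoc, hg, map_inv]
    group
  have heq := (hφ.cosetMap_bijective σ₁ _).1 hcos
  cases congrArg (fun z => z.1.1) heq
  obtain ⟨j, hj⟩ := QuotientGroup.eq.1 (eq_of_heq (Sigma.mk.inj heq).2)
  rw [inv_one, one_mul] at hj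
  subst hj
  refine mk_eq _ j ?_ ?_
  · exact XPath.append_edge_cancel _ (hp.trans (XPath.append_slide p₂ a₁ j).symm)
  · change φ.el a₁ * 𝕐.ψ (φ.f.onE a₁) g₂ =
      φ.loc σ₁ (𝕏.ψ a₁ j) * (φ.el a₁ * 𝕐.ψ (φ.f.onE a₁) g₁) at hg
    -- By `conj_el`, `φ(ψ(j)) φ(a₁) = φ(a₁) ψ(φ(j))`, so `φ(a₁)` cancels, and then `ψ` does by
    -- injectivity.
    apply 𝕐.ψ_injective (φ.f.onE a₁)
    change _ = 𝕐.ψ (φ.f.onE a₁) (φ.loc ρ₁ j * g₁)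
    rw [← φ.conj_el a₁ j] at hg
    rw [map_mul]
    apply mul_left_cancel (a := φ.el a₁)
    rw [hg]
    group

/-- Transport along an edge, as a bijection. -/
noncomputable def crossEquiv (hφ : φ.IsCovering) {ρ τ : Y.V} (a : Y.Edge ρ τ) :
    φ.Fibre σ₀ ρ ≃ φ.Fibre σ₀ τ :=
  Equiv.ofBijective (cross a) ⟨cross_injective hφ a, cross_surjective hφ a⟩

theorem crossEquiv_rmul (hφ : φ.IsCovering) {ρ τ : Y.V} (a : Y.Edge ρ τ) (x : φ.Fibre σ₀ ρ)
    (g : 𝕐.G ρ) : crossEquiv hφ a (x.rmul g) = (crossEquiv hφ a x).rmul (𝕐.ψ a g) :=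
  cross_rmul a x g

theorem crossEquiv_symm_rmul (hφ : φ.IsCovering) {ρ τ : Y.V} (a : Y.Edge ρ τ)
    (x : φ.Fibre σ₀ τ) (g : 𝕐.G ρ) :
    (crossEquiv hφ a).symm (x.rmul (𝕐.ψ a g)) = ((crossEquiv hφ a).symm x).rmul g := by
  rw [Equiv.symm_apply_eq, crossEquiv_rmul, Equiv.apply_symm_apply]

theorem crossEquiv_comp (hφ : φ.IsCovering) {ρ σ τ : Y.V} (a : Y.Edge σ τ) (b : Y.Edge ρ σ)
    (x : φ.Fibre σ₀ ρ) : crossEquiv hφ a (crossEquiv hφ b x) =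
      (crossEquiv hφ (Y.comp a b) x).rmul (𝕐.tw a b)⁻¹ :=
  cross_cross a b x

theorem crossEquiv_comp_symm (hφ : φ.IsCovering) {ρ σ τ : Y.V} (a : Y.Edge σ τ)
    (b : Y.Edge ρ σ) (x : φ.Fibre σ₀ τ) :
    (crossEquiv hφ b).symm ((crossEquiv hφ a).symm x) =
      (crossEquiv hφ (Y.comp a b)).symm (x.rmul (𝕐.tw a b)) := by
  rw [Equiv.symm_apply_eq, Equiv.symm_apply_eq, crossEquiv_comp, Equiv.apply_symm_apply,
    rmul_rmul, mul_inv_cancel, rmul_one]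

/-! ### Transport along paths and its homotopy invariance. -/

/-- Transport along a path. -/
noncomputable def transport (hφ : φ.IsCovering) :
    {ρ τ : Y.V} → XPath 𝕐 ρ τ → φ.Fibre σ₀ ρ → φ.Fibre σ₀ τ
  | _, _, .nil g, x => x.rmul g
  | _, _, .cons g (Sum.inl a) q, x => transport hφ q (crossEquiv hφ a (x.rmul g))
  | _, _, .cons g (Sum.inr a) q, x => transport hφ q ((crossEquiv hφ a).symm (x.rmul g))

theorem transport_lmul (hφ : φ.IsCovering) {ρ τ : Y.V} (g : 𝕐.G ρ) (q : XPath 𝕐 ρ τ)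
    (x : φ.Fibre σ₀ ρ) : transport hφ (q.lmul g) x = transport hφ q (x.rmul g) := by
  rcases q with h | ⟨h, a | a, q⟩ <;> simp [XPath.lmul, transport, rmul_rmul]

theorem transport_append (hφ : φ.IsCovering) {ρ σ τ : Y.V} (p : XPath 𝕐 ρ σ) (q : XPath 𝕐 σ τ)
    (x : φ.Fibre σ₀ ρ) : transport hφ (p.append q) x = transport hφ q (transport hφ p x) := by
  induction p with
  | nil g => simp [XPath.append, transport, transport_lmul]
  | cons g e p ih => rcases e with a | a <;> simp [XPath.append, transport, ih]

/-- Slides express the compatibility of `crossEquiv` with `rmul`, reductions also use that it is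
invertible, and shortcuts are the twisted composition rule. -/
theorem transport_move (hφ : φ.IsCovering) {ρ τ : Y.V} {p q : XPath 𝕐 ρ τ}
    (h : XPath.Move p q) (x : φ.Fibre σ₀ ρ) : transport hφ p x = transport hφ q x := by
  cases h with
  | slide a k g h => simp [XPath.seg, transport, ← rmul_rmul, crossEquiv_rmul]
  | slideInv a g h k => simp [XPath.seg, transport, ← rmul_rmul, crossEquiv_symm_rmul]
  | reduce a g h k => simp [XPath.seg, transport, ← rmul_rmul, crossEquiv_symm_rmul]
  | reduceInv b g k h => simp [XPath.seg, transport, ← rmul_rmul, crossEquiv_rmul]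
  | shortcut a b g k => simp [XPath.seg, transport, ← rmul_rmul, rmul_one, crossEquiv_comp]
  | shortcutInv a b g k =>
    simp [XPath.seg, transport, ← rmul_rmul, rmul_one, crossEquiv_comp_symm]

theorem transport_homotopic (hφ : φ.IsCovering) {ρ τ : Y.V} {p q : XPath 𝕐 ρ τ}
    (h : XPath.Homotopic p q) (x : φ.Fibre σ₀ ρ) : transport hφ p x = transport hφ q x := by
  induction h with
  | refl _ => rfl
  | symm _ _ _ ih => exact ih.symm
  | trans _ _ _ _ _ ih ih' => exact ih.trans ih'
  | rel p q h =>
    obtain ⟨l, h, r⟩ := h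
    simp only [transport_append, transport_move hφ h]

/-- Transport along an image path just prolongs `p`: a group element is absorbed since `(p, φ(g)) =
(p ⋆ (g), 1)`, and the factors `φ(a)` from `cross` cancel those in `onPath`. -/
theorem transport_onPath (hφ : φ.IsCovering) {σ τ : X.V} (p : XPath 𝕏 σ₀ σ) (q : XPath 𝕏 σ τ) :
    transport hφ (φ.onPath q) (mk rfl p 1) = mk rfl (p.append q) 1 := by
  have hnil : ∀ {σ : X.V} (p : XPath 𝕏 σ₀ σ) (g : 𝕏.G σ),
      (mk rfl p 1 : φ.Fibre σ₀ (φ.f.onV σ)).rmul (φ.loc σ g) = mk rfl (p.append (.nil g)) 1 :=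
    fun p g => (mk_eq rfl g (XPath.Homotopic.refl _) (by rw [one_mul, mul_one]; rfl)).symm
  have hedge : ∀ {σ τ : X.V} (p : XPath 𝕏 σ₀ σ) (a : X.Edge σ τ),
      crossEquiv hφ (φ.f.onE a) (mk rfl p 1) =
        mk rfl (p.append (.seg 1 (Sum.inl a) 1)) (φ.el a) := fun p a => by
    refine (cross_mk (a' := a) rfl rfl p 1).trans ?_
    rw [map_one, mul_one]
    rfl
  induction q with
  | nil g => exact hnil p g
  | cons g e q ih =>
    rcases e with a | a
    · have h1 := ih (p.append (.seg g (Sum.inl a) 1))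
      rw [XPath.append_assoc] at h1
      simp only [onPath, transport_append, transport, XPath.seg, rmul_one, hnil, hedge, mk_rmul,
        mul_inv_cancel, XPath.append_assoc]
      simpa [XPath.append, XPath.seg, XPath.lmul_nil, XPath.lmul_cons, XPath.one_lmul] using h1
    · have h1 := ih (p.append (.seg g (Sum.inr a) 1))
      rw [XPath.append_assoc] at h1
      -- For an inverse edge, crossing `f(a)` forwards again must restore `(p ⋆ (g), φ(a))`; this is
      -- a reduction in `𝕏`.
      have h2 : (crossEquiv hφ (φ.f.onE a)).symm
          ((mk rfl (p.append (.nil g)) 1 : φ.Fibre σ₀ _).rmul (φ.el a)) =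
            mk rfl (p.append (.seg g (Sum.inr a) 1)) 1 := by
        rw [Equiv.symm_apply_eq, hedge, mk_rmul, one_mul]
        refine (mk_eq rfl 1 ?_ (by simp)).symm
        rw [XPath.append_one, XPath.append_assoc]
        refine XPath.Homotopic.append_left p ?_
        simpa [XPath.append, XPath.seg, XPath.lmul] using
          (XPath.Move.reduceInv a g 1 1).homotopic
      simp only [onPath, transport_append, transport, XPath.seg, rmul_one, hnil, h2]
      simpa [XPath.append, XPath.seg, XPath.lmul_nil, XPath.lmul_cons, XPath.one_lmul] using h1

/-! ### The left inverse of `tilde` on vertices. -/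

/-- The vertex of the universal complex determined by an element of a fibre. -/
def toVertex {τ : Y.V} (x : φ.Fibre σ₀ τ) : (𝕏.universalComplex σ₀).V :=
  Quotient.lift (fun y : φ.LiftedPath σ₀ τ => vertex y.path) (by
    rintro _ _ ⟨σ, hσ, p, q, g, h, k, hp, hg⟩
    exact congrArg (Sigma.mk σ) (Quotient.sound (XPath.Equivalent.symm ⟨k, hp⟩))) x

theorem toVertex_rmul {τ : Y.V} (x : φ.Fibre σ₀ τ) (g : 𝕐.G τ) :
    (x.rmul g).toVertex = x.toVertex := by
  obtain ⟨σ, hσ, p, h, rfl⟩ := x.exists_mk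
  rfl

end Fibre

/-- The vertex of the universal complex of `𝕏` at the end of the lift of a path in `𝕐`. -/
noncomputable def liftVertex (hφ : φ.IsCovering) (σ₀ : X.V)
    (y : (𝕐.universalComplex (φ.f.onV σ₀)).V) : (𝕏.universalComplex σ₀).V :=
  Quotient.lift (fun q : XPath 𝕐 (φ.f.onV σ₀) y.1 =>
      (Fibre.transport hφ q (Fibre.mk rfl (.nil 1) 1)).toVertex) (by
    rintro p q ⟨g, h⟩
    -- Equivalent paths differ by a final `(g)`, which changes only the group element of the
    -- endpoint, and `toVertex` forgets it.
    rw [Fibre.transport_homotopic hφ h, Fibre.transport_append]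
    exact (Fibre.toVertex_rmul _ g).symm) y.2

theorem liftVertex_tilde (hφ : φ.IsCovering) (σ₀ : X.V) :
    Function.LeftInverse (liftVertex hφ σ₀) (φ.tilde σ₀).onV := by
  rintro ⟨σ, ⟨p⟩⟩
  change (Fibre.transport hφ (φ.onPath p) (Fibre.mk rfl (.nil 1) 1)).toVertex = _
  rw [Fibre.transport_onPath]
  exact congrArg vertex (XPath.one_lmul p)

/-! ### Lifting paths and surjectivity. -/

/-- Every path issuing from `f(σ)` is, up to homotopy and an element of the local group at its
terminal vertex, the image of a path issuing from `σ`. -/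
theorem exists_lift_path (hφ : φ.IsCovering) {ρ τ : Y.V} (q : XPath 𝕐 ρ τ) {σ : X.V}
    (hσ : φ.f.onV σ = ρ) : ∃ (σ' : X.V) (p : XPath 𝕏 σ σ') (hσ' : φ.f.onV σ' = τ) (g : 𝕐.G τ),
      XPath.Homotopic (hσ ▸ q) (XPath.append (hσ' ▸ φ.onPath p) (.nil g)) := by
  -- Lifting an edge leaves a group element in front of the rest of the path, so the induction must
  -- allow a left factor `k`.
  suffices H : ∀ (k : 𝕐.G ρ) (σ : X.V) (hσ : φ.f.onV σ = ρ), ∃ (σ' : X.V) (p : XPath 𝕏 σ σ')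
      (hσ' : φ.f.onV σ' = τ) (g : 𝕐.G τ),
      XPath.Homotopic (hσ ▸ q.lmul k) (XPath.append (hσ' ▸ φ.onPath p) (.nil g)) by
    simpa [XPath.one_lmul] using H 1 σ hσ
  clear hσ σ
  induction q with
  | nil g =>
    rintro k σ rfl
    refine ⟨σ, .nil 1, rfl, k * g, ?_⟩
    simpa [onPath, XPath.append, XPath.lmul] using XPath.Homotopic.refl _
  | @cons ρ π τ g e q ih =>
    rintro k σ rfl
    rcases e with a | a
    · obtain ⟨⟨π', a'⟩, ha⟩ := φ.f.exists_lift_edge rfl a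
      cases ha
      -- Slide `k g` across the edge and insert `φ(a')⁻¹ φ(a')`: the first factor completes the
      -- image of `a'`, the second is passed on.
      obtain ⟨σ', p, rfl, g', h⟩ := ih (φ.el a' * 𝕐.ψ (φ.f.onE a') (k * g)) π' rfl
      refine ⟨σ', .cons 1 (Sum.inl a') p, rfl, g', ?_⟩
      have h1 := (XPath.Move.slide (φ.f.onE a') 1 (k * g) 1).homotopic.append_right q
      have h2 := h.append_left (XPath.seg 1 (Sum.inl (φ.f.onE a')) (φ.el a')⁻¹)
      simp only [XPath.append, XPath.seg, XPath.one_lmul, XPath.lmul_lmul, inv_mul_cancel_left,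
        one_mul, mul_one] at h1 h2
      simpa [onPath, XPath.append, XPath.seg, XPath.lmul_nil, XPath.lmul_cons,
        XPath.one_lmul, XPath.lmul_append] using h1.trans h2
    -- Decompose `k g = φ(j) φ(a') ψ(l)`: the lift begins with `(j, a'⁻¹)`, and `l` slides across
    -- the inverse edge to the rest of the path.
    · obtain ⟨⟨⟨⟨π', a'⟩, ha⟩, j⟩, hj⟩ :=
        (hφ.cosetMap_bijective σ ⟨π, a⟩).2 (QuotientGroup.mk (k * g))
      cases ha
      obtain ⟨j⟩ := j
      obtain ⟨l, hl⟩ := QuotientGroup.eq.1 hj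
      change 𝕐.ψ (φ.f.onE a') l = (φ.loc σ j * φ.el a')⁻¹ * (k * g) at hl
      rw [eq_inv_mul_iff_mul_eq] at hl
      obtain ⟨σ', p, rfl, g', h⟩ := ih l π' rfl
      refine ⟨σ', .cons j (Sum.inr a') p, rfl, g', ?_⟩
      have h1 := (XPath.Move.slideInv (φ.f.onE a') (φ.loc σ j * φ.el a') l
        1).homotopic.symm.append_right q
      have h2 := h.append_left (XPath.seg (φ.loc σ j * φ.el a') (Sum.inr (φ.f.onE a')) 1)
      simp only [XPath.append, XPath.seg, XPath.one_lmul, mul_one, hl] at h1 h2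
      simpa [onPath, XPath.append, XPath.seg, XPath.lmul_nil, XPath.lmul_cons,
        XPath.one_lmul, XPath.lmul_append] using h1.trans h2

theorem tilde_onV_surjective (hφ : φ.IsCovering) (σ₀ : X.V) :
    Function.Surjective (φ.tilde σ₀).onV := by
  rintro ⟨τ, ⟨q⟩⟩
  obtain ⟨σ, p, rfl, g, h⟩ := exists_lift_path hφ q rfl
  exact ⟨vertex p, congrArg (Sigma.mk _) (Quotient.sound ⟨g, h⟩)⟩

/-- The morphism of universal complexes induced by a covering is an isomorphism. -/
theorem IsCovering.tilde_isIso (hφ : φ.IsCovering) (σ₀ : X.V) : (φ.tilde σ₀).IsIso :=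
  (φ.tilde σ₀).isIso_of_bijective_onV
    ⟨(liftVertex_tilde hφ σ₀).injective, tilde_onV_surjective hφ σ₀⟩

/-! ### Equivariance. -/

variable (φ) in
theorem onPathClass_translate {σ₀ τ : X.V} (g : 𝕏.FundGroup σ₀) (x : 𝕏.PathClass σ₀ τ) :
    φ.onPathClass (x.translate g) = (φ.onPathClass x).translate (φ.onFundGroup σ₀ g) := by
  obtain ⟨q⟩ := g
  obtain ⟨p⟩ := x
  exact congrArg (Quotient.mk _) (φ.onPath_append q p)

variable (φ) in
/-- The morphism of universal complexes is equivariant with respect to the homomorphism of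
fundamental groups. -/
theorem tilde_isEquivariant (σ₀ : X.V) :
    (φ.tilde σ₀).IsEquivariant (𝕏.universalAction σ₀) (𝕐.universalAction (φ.f.onV σ₀))
      (φ.onFundGroup σ₀) :=
  ⟨fun g x => Sigma.ext rfl (heq_of_eq (φ.onPathClass_translate g x.2)),
    fun g x _ a => 𝕐.universalComplex_tot_eq (φ.f.onE a.1) _ _ (φ.onPathClass_translate g x.2)⟩

end Hom

end ComplexOfGroups

theorem mainTheorem5 {X : Scwol.{u, v}} {Y : Scwol.{u', v'}}
    (𝕏 : ComplexOfGroups.{u, v, w} X) (𝕐 : ComplexOfGroups.{u', v', w'} Y)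
    (hX : X.Connected) (hY : Y.Connected)
    (h𝕏 : 𝕏.Developable) (h𝕐 : 𝕐.Developable)
    (φ : ComplexOfGroups.Hom 𝕏 𝕐) (hφ : φ.IsCovering) (σ₀ : X.V) :
    (φ.tilde σ₀).IsEquivariant (𝕏.universalAction σ₀) (𝕐.universalAction (φ.f.onV σ₀))
      (φ.onFundGroup σ₀) ∧
    (φ.tilde σ₀).IsIso :=
  ⟨φ.tilde_isEquivariant σ₀, hφ.tilde_isIso σ₀⟩
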